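/- A \emph{polytope} $Q$ is a convex polyhedron in $\mathbb{R}^3$, i.e. the convex hull of finitely many points, which is either three-dimensional, with surface its boundary, or \emph{flat}, i.e. a planar convex polygon, with surface the doubly covered polygon (two copies of the polygon glued along their boundary). The \emph{curvature} of a point of the surface of $Q$ is $2\pi$ minus the sum of the face angles incident to that point. A \emph{vertex} of $Q$ is a point of the surface with nonzero curvature; a vertex is \emph{sharp} if its curvature is at least $\pi$. Let $T_C$ be a geometric tree drawn on the surface of $Q$, each arc of which is a polygonal path; a \emph{leaf} of $T_C$ is an end point of $T_C$, i.e. a node with exactly one incident segment. $Q$ has a \emph{convex unfolding via the cut tree} $T_C$ if cutting the surface of $Q$ along $T_C$ and flattening it isometrically, without overlap, yields a convex polygon $P$ in the plane. Equivalently, $P$ folds onto the surface of $Q$ by a continuous, piecewise isometric map (finitely many convex polygonal pieces covering $P$ are mapped isometrically into faces of $Q$) that sends the interior of $P$ bijectively onto the complement of $T_C$ and the boundary of $P$ onto $T_C$. \textbf{Theorem.} If a polytope $Q$ has a convex unfolding via a cut tree $T_C$, then each leaf of $T_C$ is at a sharp vertex of $Q$. Moreover, $Q$ must have at least two sharp vertices.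 -/

import Mathlib

open scoped RealInnerProductSpace

noncomputable section

/-- The Euclidean plane. -/
abbrev E2 := EuclideanSpace ℝ (Fin 2)

/-- Euclidean space. -/
abbrev E3 := EuclideanSpace ℝ (Fin 3)

/-- A convex polygon: the convex hull of finitely many points of the plane, with nonempty
interior. -/
def IsConvexPolygon (P : Set E2) : Prop :=
  (∃ s : Finset E2, P = convexHull ℝ (s : Set E2)) ∧ (interior P).Nonempty

/-- The angle of a planar convex polygon `F` in space at its point `x`: it is `2 * π` at the points
of the relative interior, and otherwise the largest angle between two segments from `x` to points
of `F` (thus `π` at a point in the interior of an edge). -/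
def faceAngle (F : Set E3) (x : E3) : ℝ :=
  open Classical in
  if x ∈ intrinsicInterior ℝ F then 2 * Real.pi
  else sSup {θ : ℝ | ∃ y ∈ F, ∃ z ∈ F, y ≠ x ∧ z ≠ x ∧ θ = EuclideanGeometry.angle y x z}

/-- A polytope: the convex hull of finitely many points of space, of dimension three, or of
dimension two.  In the second case it is the flat polytope, whose surface is the doubly covered
convex polygon. -/
structure Polytope where
  generators : Finset E3
  two_le_dim : 2 ≤ Module.finrank ℝ (vectorSpan ℝ (generators : Set E3))

namespace Polytope

/-- The underlying convex set. -/
def carrier (Q : Polytope) : Set E3 := convexHull ℝ (Q.generators : Set E3)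

/-- The set of points of the polytope that are extreme in direction `u`. -/
def face (Q : Polytope) (u : E3) : Set E3 :=
  {x | x ∈ Q.carrier ∧ ∀ y ∈ Q.carrier, ⟪u, y⟫ ≤ ⟪u, x⟫}

/-- The outward unit normals of the two-dimensional faces.  They label the sheets of the surface:
a solid polytope has one for each facet, and a flat polytope has exactly two, opposite to each
other, whose faces are both equal to the whole polygon. -/
def sheets (Q : Polytope) : Set E3 :=
  {u | ‖u‖ = 1 ∧ Module.finrank ℝ (vectorSpan ℝ (Q.face u)) = 2}

/-- A point of the surface of a polytope is recorded by its location in space and by the set of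
(the outward unit normals of) all sheets of the surface that are incident to it.  The second
component only serves to keep the two sides of a flat polytope apart. -/
@[ext]
structure SurfacePoint where
  loc : E3
  incident : Set E3

/-- The surface point at location `x` of the sheet `u`.  A point in the relative interior of the
sheet is incident to this sheet only.  A point on the relative boundary of the sheet is incident to
all sheets that contain it.  Thus `Q.point u x = Q.point v x` if and only if `u = v` or `x` is on the
common boundary of the two sheets; in particular, the two sides of a flat polytope
are glued along the boundary of the polygon. -/
def point (Q : Polytope) (u x : E3) : SurfacePoint where
  loc := x
  incident := {v | v ∈ Q.sheets ∧ x ∈ Q.face v ∧ (v = u ∨ x ∉ intrinsicInterior ℝ (Q.face u))}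

/-- The surface of the polytope. -/
def surface (Q : Polytope) : Set SurfacePoint :=
  {p | ∃ u ∈ Q.sheets, ∃ x ∈ Q.face u, p = Q.point u x}

/-- The curvature of a surface point: `2 * π` minus the sum of the incident face angles.
The sum is finite by `Polytope.finite_sheets` below. -/
def curvature (Q : Polytope) (p : SurfacePoint) : ℝ :=
  2 * Real.pi - ∑ᶠ u ∈ p.incident, faceAngle (Q.face u) p.loc

/-- A vertex is a point of the surface with nonzero curvature. -/
def IsVertex (Q : Polytope) (p : SurfacePoint) : Prop :=
  p ∈ Q.surface ∧ Q.curvature p ≠ 0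

/-- A sharp vertex is a vertex of curvature at least `π`. -/
def IsSharpVertex (Q : Polytope) (p : SurfacePoint) : Prop :=
  Q.IsVertex p ∧ Real.pi ≤ Q.curvature p

/-- The straight segment between (the locations of) two surface points drawn on the sheet `u`. -/
def segmentOn (Q : Polytope) (u : E3) (p q : SurfacePoint) : Set SurfacePoint :=
  Q.point u '' segment ℝ p.loc q.loc

/-- A geometric tree drawn on the surface of a polytope with polygonal arcs, presented by its
straight segments: the nodes are finitely many distinct points of the surface, and adjacent nodes
are joined by a straight segment on some sheet. (A polygonal arc is a chain of such edges.)
Two distinct segments have no common points besides common end points. -/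
structure GeometricTree (Q : Polytope) where
  size : ℕ
  node : Fin size → SurfacePoint
  node_mem : ∀ i, node i ∈ Q.surface
  node_injective : Function.Injective node
  graph : SimpleGraph (Fin size)
  isTree : graph.IsTree
  /-- The sheet that carries the segment between two adjacent nodes. -/
  sheet : Fin size → Fin size → E3
  sheet_symm : ∀ i j, sheet i j = sheet j i
  sheet_mem : ∀ i j, graph.Adj i j → sheet i j ∈ Q.sheets
  node_mem_sheet : ∀ i j, graph.Adj i j →
    (node i).loc ∈ Q.face (sheet i j) ∧ Q.point (sheet i j) (node i).loc = node i
  inter_subset : ∀ i j k l, graph.Adj i j → graph.Adj k l → s(i, j) ≠ s(k, l) →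
    Q.segmentOn (sheet i j) (node i) (node j) ∩ Q.segmentOn (sheet k l) (node k) (node l) ⊆
      {node i, node j} ∩ {node k, node l}

namespace GeometricTree

variable {Q : Polytope}

/-- The set of points of the tree. -/
def support (T : Q.GeometricTree) : Set SurfacePoint :=
  Set.range T.node ∪
    {p | ∃ i j, T.graph.Adj i j ∧ p ∈ Q.segmentOn (T.sheet i j) (T.node i) (T.node j)}

/-- The node `i` is a leaf: it has exactly one incident segment. -/
def IsLeaf (T : Q.GeometricTree) (i : Fin T.size) : Prop :=
  ∃! j, T.graph.Adj i j

end GeometricTree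

/-- `f` folds the planar region `P` to the surface of `Q`, with the boundary of `P` going to the
tree `T`.  That is, cutting the surface along `T` and flattening it gives the region `P`,
and `f` puts the points of `P` back to their places on the surface.
Flattening is isometric: `P` is covered by finitely many convex polygons, each of which is
carried by `f` isometrically into one sheet of the surface.  (As `f` is well defined on the
overlaps of these closed pieces, it is continuous on `P`.)  The interior of `P` corresponds
one-to-one to the complement of `T` in the surface, and the boundary of `P` is mapped onto `T`. -/
structure IsFolding (Q : Polytope) (T : Q.GeometricTree) (P : Set E2) (f : E2 → SurfacePoint) :
    Prop where
  piecewise_isometric : ∃ (m : ℕ) (piece : Fin m → Finset E2) (sheet : Fin m → E3)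
    (φ : Fin m → E2 → E3),
      P = ⋃ k, convexHull ℝ (piece k : Set E2) ∧
      ∀ k, sheet k ∈ Q.sheets ∧
        (∀ x ∈ convexHull ℝ (piece k : Set E2), ∀ y ∈ convexHull ℝ (piece k : Set E2),
          dist (φ k x) (φ k y) = dist x y) ∧
        ∀ x ∈ convexHull ℝ (piece k : Set E2),
          φ k x ∈ Q.face (sheet k) ∧ f x = Q.point (sheet k) (φ k x)
  bijOn_interior : Set.BijOn f (interior P) (Q.surface \ T.support)
  image_frontier : f '' frontier P = T.support

/-- The polytope has a convex unfolding via the cut tree `T`. -/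
def HasConvexUnfoldingVia (Q : Polytope) (T : Q.GeometricTree) : Prop :=
  ∃ P : Set E2, IsConvexPolygon P ∧ ∃ f : E2 → SurfacePoint, Q.IsFolding T P f

/-! Finiteness of the number of sheets, so that the sum of face angles is an honest sum. -/

theorem isCompact_carrier (Q : Polytope) : IsCompact Q.carrier :=
  Set.Finite.isCompact_convexHull (𝕜 := ℝ) Q.generators.finite_toSet

theorem isExposed_face (Q : Polytope) (u : E3) : IsExposed ℝ Q.carrier (Q.face u) :=
  fun _ => ⟨innerSL ℝ u, rfl⟩

theorem face_eq_of_extremePoints_eq (Q : Polytope) {u v : E3}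
    (h : (Q.face u).extremePoints ℝ = (Q.face v).extremePoints ℝ) : Q.face u = Q.face v := by
  have key : ∀ w, closure (convexHull ℝ ((Q.face w).extremePoints ℝ)) = Q.face w := fun w =>
    closure_convexHull_extremePoints ((Q.isExposed_face w).isCompact Q.isCompact_carrier)
      ((Q.isExposed_face w).convex (convex_convexHull ℝ _))
  rw [← key u, ← key v, h]

theorem extremePoints_face_subset (Q : Polytope) (u : E3) :
    (Q.face u).extremePoints ℝ ⊆ (Q.generators : Set E3) :=
  (IsExtreme.extremePoints_subset_extremePoints (𝕜 := ℝ) (Q.isExposed_face u).isExtreme).trans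
    (extremePoints_convexHull_subset (𝕜 := ℝ))

theorem mem_orthogonal_vectorSpan_face (Q : Polytope) (u : E3) :
    u ∈ (vectorSpan ℝ (Q.face u))ᗮ := by
  rw [Submodule.mem_orthogonal']
  intro w hw
  rw [vectorSpan_def] at hw
  induction hw using Submodule.span_induction with
  | mem x hx =>
    obtain ⟨a, ha, b, hb, rfl⟩ := hx
    have h1 := ha.2 b hb.1
    have h2 := hb.2 a ha.1
    simp only [vsub_eq_sub, inner_sub_right]
    linarith
  | zero => simp
  | add x y _ _ hx hy => rw [inner_add_right, hx, hy, add_zero]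
  | smul a x _ hx => rw [inner_smul_right, hx, mul_zero]

theorem eq_or_eq_neg_of_face_eq (Q : Polytope) {u v : E3} (hu : u ∈ Q.sheets)
    (hv : v ∈ Q.sheets) (h : Q.face u = Q.face v) : v = u ∨ v = -u := by
  have hfr : Module.finrank ℝ (vectorSpan ℝ (Q.face u))ᗮ = 1 := by
    have h1 := (vectorSpan ℝ (Q.face u)).finrank_add_finrank_orthogonal
    rw [hu.2, finrank_euclideanSpace_fin] at h1
    omega
  have hu0 : u ≠ 0 := by
    rintro rfl
    simpa using hu.1
  obtain ⟨c, hc⟩ := exists_smul_eq_of_finrank_eq_one hfr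
    (x := ⟨u, Q.mem_orthogonal_vectorSpan_face u⟩) (by simpa using hu0)
    ⟨v, h ▸ Q.mem_orthogonal_vectorSpan_face v⟩
  have hc' : c • u = v := congrArg Subtype.val hc
  have hn : |c| = 1 := by
    have := hv.1
    rwa [← hc', norm_smul, hu.1, mul_one, Real.norm_eq_abs] at this
  rcases eq_or_eq_neg_of_abs_eq hn with rfl | rfl
  · left; simpa using hc'.symm
  · right; simpa using hc'.symm

theorem finite_sheets (Q : Polytope) : Q.sheets.Finite := by
  refine Set.Finite.of_finite_fibers (fun u => (Q.face u).extremePoints ℝ) ?_ ?_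
  · refine Q.generators.finite_toSet.finite_subsets.subset ?_
    rintro _ ⟨u, _, rfl⟩
    exact Q.extremePoints_face_subset u
  · rintro _ ⟨u, hu, rfl⟩
    refine (Set.toFinite {u, -u}).subset ?_
    rintro v ⟨hv, hvu⟩
    exact Q.eq_or_eq_neg_of_face_eq hu hv (Q.face_eq_of_extremePoints_eq hvu.symm)

end Polytope

end

open MeasureTheory Set

/-! ### Planar areas -/

/-! Angles are compared through areas of small discs. Near a surface point with total face angle
`A`, the surface within distance `r` has at least about the fraction `A / (2 * π)` of the area of a
disc of radius `r`. A convex region has at most half of a disc around each of its boundary points.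
So if a leaf has exactly one preimage `p` on the boundary of `P`, the surface near the leaf is no
larger than `P` near `p`. This gives `A ≤ π`, that is, curvature at least `π`.

The core is that a leaf has only one preimage (`eq_of_apply_eq_leaf`). Suppose `p` and `p'` both go
to the leaf. A small circle of radius `r` around `p` meets the boundary of `P` in two points, and
the circle around `p'` in at least one. All three must go to the single point at distance `r` from
the leaf on the only segment there. None of them is a corner of `P`, so `P` has half a disc at each:
one and a half discs in all. But a point inside a straight segment on a sheet is either interior to
a face or on an edge of at most two sheets, so the surface has at most one disc around it.

The two transfers of area are `exists_sum_area_le` (injectivity on the interior makes the areas near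
several preimages add up) and `exists_sum_area_face_le` (a unique preimage receives all of the
area). Both rest on the fact that maps which contract each piece of a finite cover do not increase
`μH[2]`. This measure makes sense for faces in space as well as for regions in the plane, where it
is a Haar measure.

Finally, a tree with more than one node has two leaves, and one node is not enough because the
folding cannot collapse the boundary of `P` to a point. -/

instance isAddHaarMeasure_area : (μH[2] : Measure E2).IsAddHaarMeasure := by
  simpa using MeasureTheory.isAddHaarMeasure_hausdorffMeasure (E := E2)

/-- The area of a disc of radius `r`. -/
noncomputable def discArea (r : ℝ) : ENNReal := μH[2] (Metric.ball (0 : E2) r)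

theorem hausdorffMeasure_ball (q : E2) (r : ℝ) : μH[2] (Metric.ball q r) = discArea r :=
  Measure.addHaar_ball_center _ q r

theorem discArea_ne_top (r : ℝ) : discArea r ≠ ⊤ := measure_ball_lt_top.ne

theorem discArea_ne_zero {r : ℝ} (hr : 0 < r) : discArea r ≠ 0 :=
  (Metric.measure_ball_pos _ _ hr).ne'

theorem hausdorffMeasure_pointReflection_image (q : E2) (s : Set E2) :
    μH[2] (AffineIsometryEquiv.pointReflection ℝ q '' s) = μH[2] s :=
  (AffineIsometryEquiv.isometry _).hausdorffMeasure_image (Or.inl (by norm_num)) s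

/-- A line through `q` has the interior of `s` strictly on one side, so the point reflection in `q`
gives a disjoint copy of the part in the disc, of equal area. The frontier of a convex set is null.
-/
theorem Convex.two_mul_area_inter_ball_le {s : Set E2} (hs : Convex ℝ s) {q : E2}
    (hq : q ∉ interior s) (r : ℝ) : 2 * μH[2] (s ∩ Metric.ball q r) ≤ discArea r := by
  obtain ⟨f, hf⟩ := geometric_hahn_banach_open_point hs.interior isOpen_interior hq
  set A := interior s ∩ Metric.ball q r with hA
  have h1 : μH[2] (s ∩ Metric.ball q r) ≤ μH[2] A := by
    calc μH[2] (s ∩ Metric.ball q r) ≤ μH[2] (A ∪ frontier s) := by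
          refine measure_mono fun z hz => ?_
          by_cases h : z ∈ interior s
          · exact Or.inl ⟨h, hz.2⟩
          · exact Or.inr ⟨subset_closure hz.1, h⟩
      _ ≤ μH[2] A + μH[2] (frontier s) := measure_union_le _ _
      _ = μH[2] A := by rw [hs.addHaar_frontier μH[2], add_zero]
  have h2 : μH[2] (A ∪ AffineIsometryEquiv.pointReflection ℝ q '' A) =
      μH[2] A + μH[2] (AffineIsometryEquiv.pointReflection ℝ q '' A) := by
    refine measure_union' ?_ ?_
    · rw [Set.disjoint_left]
      rintro _ hz ⟨z, hz', rfl⟩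
      have h3 := hf _ hz.1
      have h4 := hf _ hz'.1
      rw [AffineIsometryEquiv.pointReflection_apply] at h3
      simp at h3
      linarith
    · exact (isOpen_interior.inter Metric.isOpen_ball).measurableSet
  calc 2 * μH[2] (s ∩ Metric.ball q r) ≤ 2 * μH[2] A := by gcongr
    _ = μH[2] (A ∪ AffineIsometryEquiv.pointReflection ℝ q '' A) := by
        rw [h2, hausdorffMeasure_pointReflection_image, two_mul]
    _ ≤ μH[2] (Metric.ball q r) := by
        refine measure_mono (union_subset inter_subset_right ?_)
        rintro _ ⟨z, hz, rfl⟩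
        simpa using hz.2
    _ = discArea r := hausdorffMeasure_ball q r

theorem exists_mem_not_mem_line {s : Set E2} (hs : (interior s).Nonempty) (q : E2) {e : E2}
    (he : e ≠ 0) : ∃ c ∈ s, LinearIndependent ℝ ![e, c - q] := by
  by_contra! h
  obtain ⟨c, hc⟩ := hs
  have hsub : ∀ z ∈ s, z - q ∈ Submodule.span ℝ {e} := fun z hz => by
    have := h z hz
    rw [LinearIndependent.pair_iff' he] at this
    push Not at this
    obtain ⟨a, ha⟩ := this
    exact Submodule.mem_span_singleton.2 ⟨a, ha⟩
  have htop : Submodule.span ℝ {e} = ⊤ := by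
    refine Submodule.eq_top_of_nonempty_interior' _ ⟨c - q, ?_⟩
    rw [mem_interior]
    refine ⟨(fun z => z + q) ⁻¹' interior s, fun z hz => ?_, ?_, ?_⟩
    · simpa using hsub _ (interior_subset hz)
    · exact isOpen_interior.preimage (by fun_prop)
    · simpa using hc
  have h1 := finrank_span_singleton (K := ℝ) he
  rw [htop, finrank_top, finrank_euclideanSpace_fin] at h1
  omega

/-- A triangle `a b c` in `s` contains a small half disc centred at `q`; together with its
reflection in `q` it covers the disc. -/
theorem Convex.exists_le_two_mul_area_inter_ball {s : Set E2} (hs : Convex ℝ s)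
    (hi : (interior s).Nonempty) {a b q : E2} (ha : a ∈ s) (hb : b ∈ s) (hab : a ≠ b)
    (hq : q ∈ openSegment ℝ a b) :
    ∃ ε > 0, ∀ r ≤ ε, discArea r ≤ 2 * μH[2] (s ∩ Metric.ball q r) := by
  obtain ⟨x, y, hx, hy, hxy, rfl⟩ := hq
  set q := x • a + y • b with hqdef
  obtain ⟨c, hc, hli⟩ := exists_mem_not_mem_line hi q (sub_ne_zero.2 hab.symm)
  let B := basisOfLinearIndependentOfCardEqFinrank hli (by simp)
  have hB : ∀ w : E2, w = B.coord 0 w • (b - a) + B.coord 1 w • (c - q) := fun w => by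
    have := B.sum_repr w
    simpa [Fin.sum_univ_two, B] using this.symm
  have hcont : ∀ i, Continuous fun w => B.coord i w := fun i =>
    (B.coord i).continuous_of_finiteDimensional
  -- In the basis `b - a`, `c - q` the point `q + w` has barycentric weights `x(1-τ)-α`, `y(1-τ)+α`,
  -- `τ`. The bounds `min x y / 2` and `1 / 2` keep them nonnegative.
  have key : ∀ w : E2, |B.coord 0 w| < min x y / 2 → |B.coord 1 w| < 1 / 2 → 0 ≤ B.coord 1 w →
      q + w ∈ s := fun w h0 h1 h2 => by
    set α := B.coord 0 w
    set τ := B.coord 1 w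
    rw [abs_lt] at h0 h1
    have hx' := min_le_left x y
    have hy' := min_le_right x y
    have ht : 0 < 1 - τ := by linarith
    have e1 : q + w = (x * (1 - τ) - α) • a + (y * (1 - τ) + α) • b + τ • c := by
      rw [hB w]
      simp only [hqdef, smul_sub, smul_add, sub_smul, add_smul, mul_smul, mul_sub, mul_one]
      rw [smul_comm x τ a, smul_comm y τ b]
      change _ + (α • b - α • a + (τ • c - _)) = _
      abel
    have hs' := hs.sum_mem (t := Finset.univ) (w := ![x * (1 - τ) - α, y * (1 - τ) + α, τ])
      (z := ![a, b, c]) (by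
        intro i _
        fin_cases i
        · simp; nlinarith
        · simp; nlinarith
        · simpa using h2) (by
        simp [Fin.sum_univ_three]
        linear_combination (1 - τ) * hxy) (by
        intro i _
        fin_cases i <;> assumption)
    rw [e1]
    simpa [Fin.sum_univ_three] using hs'
  have hnhds : {w : E2 | |B.coord 0 w| < min x y / 2 ∧ |B.coord 1 w| < 1 / 2} ∈ nhds (0 : E2) := by
    refine IsOpen.mem_nhds ?_ ?_
    · exact (isOpen_lt (hcont 0).abs continuous_const).inter
        (isOpen_lt (hcont 1).abs continuous_const)
    · have : 0 < min x y := lt_min hx hy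
      simp [this]
  obtain ⟨ε, hε, hball⟩ := Metric.mem_nhds_iff.1 hnhds
  refine ⟨ε, hε, fun r hr => ?_⟩
  rw [← hausdorffMeasure_ball q r]
  calc μH[2] (Metric.ball q r) ≤ μH[2] ((s ∩ Metric.ball q r) ∪
        AffineIsometryEquiv.pointReflection ℝ q '' (s ∩ Metric.ball q r)) := by
        refine measure_mono fun z hz => ?_
        have hw := hball (show z - q ∈ Metric.ball (0 : E2) ε by
          rw [mem_ball_zero_iff, ← dist_eq_norm]
          exact lt_of_lt_of_le hz hr)
        rcases le_total 0 (B.coord 1 (z - q)) with h | h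
        · left
          exact ⟨by simpa using key _ hw.1 hw.2 h, hz⟩
        · right
          refine ⟨AffineIsometryEquiv.pointReflection ℝ q z, ⟨?_, by simpa using hz⟩,
            Equiv.pointReflection_involutive q z⟩
          have := key (-(z - q)) (by rw [map_neg, abs_neg]; exact hw.1)
            (by rw [map_neg, abs_neg]; exact hw.2) (by rw [map_neg]; linarith)
          rw [AffineIsometryEquiv.pointReflection_apply]
          convert this using 1
          simp [add_comm]
    _ ≤ _ := measure_union_le _ _
    _ = _ := by rw [hausdorffMeasure_pointReflection_image, two_mul]

/-! ### Circular sectors -/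

theorem volume_sector {r θ : ℝ} (hr : 0 < r) (h0 : 0 ≤ θ) (hπ : θ < Real.pi) :
    volume ((fun p : ℝ × ℝ => (!₂[p.1 * Real.cos p.2, p.1 * Real.sin p.2] : E2)) ''
      (Ioo 0 r ×ˢ Ioo 0 θ)) = ENNReal.ofReal (r ^ 2 / 2 * θ) := by
  set R : Set (ℝ × ℝ) := Ioo 0 r ×ˢ Ioo 0 θ
  -- Polar angles range over `(-π, π)`, hence the restriction `θ < π`.
  have hR : R ⊆ polarCoord.target := fun p hp =>
    ⟨hp.1.1, by linarith [hp.2.1, Real.pi_pos], hp.2.2.trans hπ⟩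
  have hRo : IsOpen R := isOpen_Ioo.prod isOpen_Ioo
  have hS : IsOpen (polarCoord.symm '' R) :=
    polarCoord.symm.isOpen_image_of_subset_source hRo hR
  have h1 : volume (polarCoord.symm '' R) = ENNReal.ofReal (r ^ 2 / 2 * θ) := by
    rw [← lintegral_indicator_one hS.measurableSet, ← lintegral_comp_polarCoord_symm]
    have h2 : ∀ p ∈ polarCoord.target, ENNReal.ofReal p.1 •
        (polarCoord.symm '' R).indicator (1 : ℝ × ℝ → ENNReal) (polarCoord.symm p) =
        R.indicator (fun p => ENNReal.ofReal p.1) p := fun p hp => by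
      by_cases hpR : p ∈ R
      · rw [indicator_of_mem hpR, indicator_of_mem (mem_image_of_mem _ hpR)]
        simp
      · rw [indicator_of_notMem hpR, indicator_of_notMem, smul_zero]
        rintro ⟨p', hp', h⟩
        exact hpR (polarCoord.symm.injOn (hR hp') hp h ▸ hp')
    rw [setLIntegral_congr_fun polarCoord.open_target.measurableSet h2,
      setLIntegral_indicator hRo.measurableSet, inter_eq_left.2 hR, Measure.volume_eq_prod,
      ← Measure.prod_restrict, lintegral_prod _ (by fun_prop)]
    simp only [lintegral_const, Measure.restrict_apply_univ, Real.volume_Ioo, sub_zero]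
    rw [lintegral_mul_const _ (by fun_prop), ← ofReal_integral_eq_lintegral_ofReal,
      ← integral_Ioc_eq_integral_Ioo, ← intervalIntegral.integral_of_le hr.le, integral_id,
      ← ENNReal.ofReal_mul' h0]
    · congr 1
      ring
    · exact (continuous_id.integrableOn_Icc (a := 0) (b := r)).mono_set Ioo_subset_Icc_self
    · exact (ae_restrict_mem measurableSet_Ioo).mono fun x hx => hx.1.le
  let e := ((MeasurableEquiv.toLp 2 (Fin 2 → ℝ)).symm.trans MeasurableEquiv.finTwoArrow)
  have he : MeasurePreserving e volume volume :=
    (volume_preserving_finTwoArrow ℝ).comp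
      (EuclideanSpace.volume_preserving_symm_measurableEquiv_toLp (Fin 2))
  rw [← h1, ← he.measure_preimage hS.measurableSet.nullMeasurableSet]
  congr 1
  ext z
  simp only [mem_image, mem_preimage]
  refine exists_congr fun p => and_congr_right fun _ => ⟨?_, fun h => ?_⟩
  · rintro rfl
    rfl
  · apply e.injective
    rw [← h]
    rfl

/-- `μH[2]` is a constant multiple of Lebesgue measure; stating the area as a fraction of `discArea`
avoids computing the constant. -/
theorem area_sector {r θ : ℝ} (hr : 0 < r) (h0 : 0 ≤ θ) (hπ : θ < Real.pi) :
    μH[2] ((fun p : ℝ × ℝ => (!₂[p.1 * Real.cos p.2, p.1 * Real.sin p.2] : E2)) ''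
      (Ioo 0 r ×ˢ Ioo 0 θ)) = ENNReal.ofReal (θ / (2 * Real.pi)) * discArea r := by
  have h := Measure.isAddLeftInvariant_eq_smul (μH[2] : Measure E2) volume
  rw [discArea, h, Measure.smul_apply, Measure.smul_apply, volume_sector hr h0 hπ,
    EuclideanSpace.volume_ball_fin_two, mul_smul_comm]
  congr 1
  rw [← ENNReal.ofReal_pow hr.le, ← ENNReal.ofReal_mul (by positivity), ← ENNReal.ofReal_mul (by positivity)]
  congr 1
  have := Real.pi_ne_zero
  field_simp

/-! ### Circles around boundary points -/

theorem isPreconnected_sphere_diff_singleton (p : E2) {s : ℝ} (hs : 0 < s) {q : E2}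
    (hq : q ∈ Metric.sphere p s) : IsPreconnected (Metric.sphere p s \ {q}) := by
  set v : E2 := s⁻¹ • (q - p)
  have hv : ‖v‖ = 1 := by
    rw [norm_smul, ← dist_eq_norm, Metric.mem_sphere.1 hq, norm_inv, Real.norm_of_nonneg hs.le,
      inv_mul_cancel₀ hs.ne']
  have h1 : IsPreconnected (Set.range (stereographic hv).symm) :=
    isPreconnected_range (isOpenEmbedding_stereographic_symm hv).continuous
  rw [range_stereographic_symm hv (by simpa using hv)] at h1
  have h2 := h1.image (fun z : Metric.sphere (0 : E2) 1 => p + s • (z : E2)) (by fun_prop)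
  convert h2 using 1
  ext z
  have hqv : q = p + s • v := by simp [v, smul_smul, hs.ne']
  constructor
  · rintro ⟨hz, hzq⟩
    have : ‖s⁻¹ • (z - p)‖ = 1 := by
      rw [norm_smul, ← dist_eq_norm, Metric.mem_sphere.1 hz, norm_inv, Real.norm_of_nonneg hs.le,
        inv_mul_cancel₀ hs.ne']
    have hz' : z = p + s • (s⁻¹ • (z - p)) := by simp [smul_smul, hs.ne']
    refine ⟨⟨s⁻¹ • (z - p), by simpa using this⟩, ?_, hz'.symm⟩
    intro h
    refine hzq ?_
    have h3 : s⁻¹ • (z - p) = v := congrArg Subtype.val h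
    rw [h3] at hz'
    exact hz'.trans hqv.symm
  · rintro ⟨⟨w, hw⟩, hwv, rfl⟩
    have hw' : ‖w‖ = 1 := by simpa using hw
    refine ⟨by simp [norm_smul, hw', hs.le], fun h => hwv ?_⟩
    have h' : p + s • w = q := h
    rw [hqv] at h'
    exact Subtype.ext (smul_right_injective _ hs.ne' (add_left_cancel h'))

/-- The point of the circle in the direction of an interior point `c` is interior; the opposite
point is beyond a supporting line, so outside `P`. A connected set through both meets the frontier.
This applies to the circle, and again to the circle without the first frontier point found. -/
theorem Convex.exists_ne_mem_frontier_sphere {P : Set E2} (hP : Convex ℝ P) (hPc : IsClosed P)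
    (hi : (interior P).Nonempty) {p : E2} (hp : p ∈ frontier P) :
    ∃ ε > 0, ∀ s, 0 < s → s < ε →
      ∃ q ∈ frontier P, ∃ q' ∈ frontier P, q ≠ q' ∧ dist q p = s ∧ dist q' p = s := by
  obtain ⟨c, hc⟩ := hi
  obtain ⟨f, hf⟩ := geometric_hahn_banach_open_point hP.interior isOpen_interior hp.2
  have hcp : c ≠ p := fun h => hp.2 (h ▸ hc)
  refine ⟨dist c p, dist_pos.2 hcp, fun s hs hsc => ?_⟩
  have hpP : p ∈ P := hPc.frontier_subset hp
  have hle : ∀ z ∈ P, f z ≤ f p := fun z hz => by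
    have : z ∈ closure (interior P) := by
      rw [hP.closure_interior_eq_closure_of_nonempty_interior ⟨c, hc⟩]
      exact subset_closure hz
    exact closure_minimal (fun w hw => (hf w hw).le) (isClosed_le f.continuous continuous_const)
      this
  set t := s / dist c p
  have hd : 0 < dist c p := dist_pos.2 hcp
  have ht0 : 0 < t := div_pos hs hd
  have ht1 : t < 1 := (div_lt_one hd).2 hsc
  have htd : t * ‖c - p‖ = s := by rw [← dist_eq_norm]; exact div_mul_cancel₀ _ hd.ne'
  have hm : p + t • (c - p) ∈ interior P := by
    have := hP.combo_interior_self_mem_interior hc hpP ht0 (sub_nonneg.2 ht1.le) (by ring)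
    convert this using 1
    module
  have hm' : p + (-t) • (c - p) ∉ P := fun h => by
    have h1 := hle _ h
    have h2 := hf c hc
    simp only [map_add, map_smul, map_sub, smul_eq_mul] at h1
    nlinarith
  have hms : p + t • (c - p) ∈ Metric.sphere p s := by
    simp [norm_smul, abs_of_pos ht0, htd]
  have hms' : p + (-t) • (c - p) ∈ Metric.sphere p s := by
    simp [norm_smul, abs_of_pos ht0, htd]
  have key : ∀ A : Set E2, IsPreconnected A → p + t • (c - p) ∈ A → p + (-t) • (c - p) ∈ A →
      (A ∩ frontier P).Nonempty := fun A hA h1 h2 => by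
    by_contra hne
    obtain ⟨z, -, hz1, hz2⟩ := hA (interior P) Pᶜ isOpen_interior hPc.isOpen_compl
      (fun z hz => by
        by_cases hzi : z ∈ interior P
        · exact Or.inl hzi
        · exact Or.inr fun hzP => hne ⟨z, hz, subset_closure hzP, hzi⟩)
      ⟨_, h1, hm⟩ ⟨_, h2, hm'⟩
    exact hz2 (interior_subset hz1)
  obtain ⟨q, hqs, hq⟩ := key _ (isPreconnected_sphere (by
    rw [← Module.finrank_eq_rank, finrank_euclideanSpace_fin]; norm_num) p s) hms hms'
  obtain ⟨q', hqs', hq'⟩ := key _ (isPreconnected_sphere_diff_singleton p hs hqs)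
    ⟨hms, fun h => hq.2 (mem_singleton_iff.1 h ▸ hm)⟩
    ⟨hms', fun h => hm' (mem_singleton_iff.1 h ▸ hPc.frontier_subset hq)⟩
  exact ⟨q, hq, q', hq', fun h => hqs'.2 h.symm, hqs, hqs'.1⟩

/-! ### Piecewise contractions -/

/-- `g` need not be continuous or Lipschitz on all of `D`: the pieces are split off one at a time,
and measurability of the pieces makes the area of `D` additive. -/
theorem hausdorffMeasure_image_le_of_cover {X Y ι : Type*} [MetricSpace X] [MeasurableSpace X]
    [BorelSpace X] [MetricSpace Y] [MeasurableSpace Y] [BorelSpace Y] [Finite ι]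
    (g : X → Y) (C : ι → Set X) (hC : ∀ i, MeasurableSet (C i)) {D : Set X}
    (hD : D ⊆ ⋃ i, C i) (hg : ∀ i, ∀ x ∈ C i ∩ D, ∀ y ∈ C i ∩ D, dist (g x) (g y) ≤ dist x y) :
    μH[2] (g '' D) ≤ μH[2] D := by
  classical
  cases nonempty_fintype ι
  suffices h : ∀ (t : Finset ι) (E : Set X), E ⊆ D → E ⊆ ⋃ i ∈ t, C i → μH[2] (g '' E) ≤ μH[2] E from
    h Finset.univ D subset_rfl (by simpa using hD)
  intro t
  induction t using Finset.induction_on with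
  | empty =>
    intro E _ hE
    have : E = ∅ := by simpa [subset_empty_iff] using hE
    simp [this]
  | insert i t _ ih =>
    intro E hED hE
    rw [← inter_union_sdiff E (C i), image_union, inter_union_sdiff,
      ← measure_inter_add_sdiff E (hC i)]
    refine (measure_union_le _ _).trans (add_le_add ?_ (ih _ (sdiff_subset.trans hED) ?_))
    · have hl : LipschitzOnWith 1 g (E ∩ C i) := LipschitzOnWith.of_dist_le_mul fun x hx y hy => by
        simpa using hg i x ⟨hx.2, hED hx.1⟩ y ⟨hy.2, hED hy.1⟩
      simpa using hl.hausdorffMeasure_image_le (d := 2) (by norm_num)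
    · rintro z ⟨hz, hzi⟩
      have := hE hz
      simp only [Finset.mem_insert, mem_iUnion, exists_prop] at this ⊢
      obtain ⟨j, rfl | hj, hzj⟩ := this
      · exact absurd hzj hzi
      · exact ⟨j, hj, hzj⟩

/-! ### Faces -/

theorem intrinsicInterior_eq_interior {F : Set E2} (hF : affineSpan ℝ F = ⊤) :
    intrinsicInterior ℝ F = interior F := by
  refine subset_antisymm ?_ interior_subset_intrinsicInterior
  have ho : IsOpen (affineSpan ℝ F : Set E2) := by
    rw [hF]
    exact isOpen_univ
  refine (ho.isOpenEmbedding_subtypeVal.isOpenMap.image_interior_subset _).trans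
    (interior_mono (image_preimage_subset _ _))

/-- A convex planar set contains a circular sector of the angle between two of its points. -/
theorem Convex.exists_angle_le_area_inter_ball {F : Set E2} (hF : Convex ℝ F)
    (hi : (interior F).Nonempty) {x y z : E2} (hx : x ∈ F) (hy : y ∈ F) (hz : z ∈ F) (hyx : y ≠ x)
    (hzx : z ≠ x) : ∃ ε > 0, ∀ r, 0 < r → r ≤ ε →
      ENNReal.ofReal (EuclideanGeometry.angle y x z / (2 * Real.pi)) * discArea r ≤
        μH[2] (F ∩ Metric.ball x r) := by
  set θ := EuclideanGeometry.angle y x z with hθ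
  have hπ0 := Real.pi_pos
  -- A straight angle is the half disc case; the sector formula needs `θ < π`.
  rcases eq_or_ne θ Real.pi with h | h
  · have hs := EuclideanGeometry.angle_eq_pi_iff_sbtw.1 (hθ.symm.trans h)
    have hyz : y ≠ z := hs.left_ne_right
    have hq : x ∈ openSegment ℝ y z := by
      rw [sbtw_iff_mem_image_Ioo_and_ne] at hs
      rw [openSegment_eq_image_lineMap]
      exact hs.1
    obtain ⟨ε, hε, H⟩ := hF.exists_le_two_mul_area_inter_ball hi hy hz hyz hq
    refine ⟨ε, hε, fun r hr hrε => ?_⟩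
    have h2 : ENNReal.ofReal (θ / (2 * Real.pi)) = 2⁻¹ := by
      rw [h, div_mul_cancel_right₀ hπ0.ne', ENNReal.ofReal_inv_of_pos (by norm_num),
        ENNReal.ofReal_ofNat]
    rw [h2, ← ENNReal.div_eq_inv_mul]
    exact ENNReal.div_le_of_le_mul' (H r hrε)
  have hθ0 : 0 ≤ θ := EuclideanGeometry.angle_nonneg _ _ _
  have hθπ : θ < Real.pi := lt_of_le_of_ne (EuclideanGeometry.angle_le_pi _ _ _) h
  rcases hθ0.eq_or_lt with h0 | h0
  · exact ⟨1, one_pos, fun r _ _ => by simp [← h0]⟩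
  have hsin : 0 < Real.sin θ := Real.sin_pos_of_pos_of_lt_pi h0 hθπ
  have hny : 0 < ‖y - x‖ := norm_pos_iff.2 (sub_ne_zero.2 hyx)
  have hnz : 0 < ‖z - x‖ := norm_pos_iff.2 (sub_ne_zero.2 hzx)
  set e : E2 := ‖y - x‖⁻¹ • (y - x) with he
  set w : E2 := ‖z - x‖⁻¹ • (z - x) with hw
  have hen : ‖e‖ = 1 := by rw [he, norm_smul, norm_inv, norm_norm, inv_mul_cancel₀ hny.ne']
  have hwn : ‖w‖ = 1 := by rw [hw, norm_smul, norm_inv, norm_norm, inv_mul_cancel₀ hnz.ne']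
  have hew : ⟪e, w⟫ = Real.cos θ := by
    rw [hθ, EuclideanGeometry.angle, InnerProductGeometry.cos_angle, he, hw, inner_smul_left,
      inner_smul_right]
    simp
    field_simp
  clear_value e w
  -- Gram–Schmidt: `e`, `n` is an orthonormal frame in which `w` is the unit vector at angle `θ`.
  set n : E2 := (Real.sin θ)⁻¹ • (w - Real.cos θ • e) with hn
  have hee : ⟪e, e⟫ = 1 := by rw [real_inner_self_eq_norm_sq, hen]; norm_num
  have hww : ⟪w, w⟫ = 1 := by rw [real_inner_self_eq_norm_sq, hwn]; norm_num
  have hen0 : ⟪e, n⟫ = 0 := by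
    rw [hn, inner_smul_right, inner_sub_right, inner_smul_right, hee, hew]
    ring
  have hnn : ⟪n, n⟫ = 1 := by
    rw [hn, inner_smul_right, inner_smul_left, inner_sub_right, inner_sub_left, inner_sub_left,
      inner_smul_right, inner_smul_left, inner_smul_left, inner_smul_right, hee, hww, hew,
      real_inner_comm, hew]
    simp
    field_simp
    linarith [Real.sin_sq_add_cos_sq θ]
  have hwe : w = Real.cos θ • e + Real.sin θ • n := by
    rw [hn, smul_inv_smul₀ hsin.ne']
    abel
  clear_value n
  let G : E2 → E2 := fun p => x + (p 0 • e + p 1 • n)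
  have hG : Isometry G := by
    refine Isometry.of_dist_eq fun p q => ?_
    have h1 : G p - G q = (p 0 - q 0) • e + (p 1 - q 1) • n := by
      simp only [G]
      module
    rw [dist_eq_norm, h1, EuclideanSpace.dist_eq, Fin.sum_univ_two, Real.dist_eq, Real.dist_eq,
      sq_abs, sq_abs]
    apply Eq.symm
    rw [Real.sqrt_eq_iff_eq_sq (by positivity) (norm_nonneg _), ← real_inner_self_eq_norm_sq]
    simp only [inner_add_left, inner_add_right, inner_smul_left, inner_smul_right, hee, hnn, hen0,
      real_inner_comm e n ▸ hen0]
    simp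
    ring
  -- Exactly the bound that makes `α + β ≤ 1` below.
  set ε := Real.sin θ * (‖y - x‖⁻¹ + ‖z - x‖⁻¹)⁻¹ with hε
  refine ⟨ε, by positivity, fun r hr hrε => ?_⟩
  rw [← area_sector hr hθ0 hθπ, ← hG.hausdorffMeasure_image (Or.inl (by norm_num))]
  refine measure_mono ?_
  rintro _ ⟨_, ⟨⟨ρ, t⟩, ⟨hρ, ht⟩, rfl⟩, rfl⟩
  have hρ0 : 0 < ρ := hρ.1
  have hρr : ρ < r := hρ.2
  have ht0 : 0 < t := ht.1
  have htθ : t < θ := ht.2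
  constructor
  -- By the law of sines, the unit vector at angle `t` has coordinates `sin (θ - t) / sin θ` and
  -- `sin t / sin θ` along `e` and `w`. So `α` and `β` are barycentric coordinates in the triangle
  -- `x y z`.
  · set α := ρ * Real.sin (θ - t) / Real.sin θ * ‖y - x‖⁻¹ with hα
    set β := ρ * Real.sin t / Real.sin θ * ‖z - x‖⁻¹ with hβ
    have s1 : 0 < Real.sin (θ - t) := Real.sin_pos_of_pos_of_lt_pi (by linarith) (by linarith)
    have s2 : 0 < Real.sin t := Real.sin_pos_of_pos_of_lt_pi (by linarith) (by linarith)
    have hα0 : 0 ≤ α := by positivity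
    have hβ0 : 0 ≤ β := by positivity
    have hαβ : α + β ≤ 1 := by
      have h1 : α ≤ ρ / Real.sin θ * ‖y - x‖⁻¹ := by
        rw [hα]
        gcongr
        nlinarith [Real.sin_le_one (θ - t)]
      have h2 : β ≤ ρ / Real.sin θ * ‖z - x‖⁻¹ := by
        rw [hβ]
        gcongr
        nlinarith [Real.sin_le_one t]
      have h3 : ρ / Real.sin θ * (‖y - x‖⁻¹ + ‖z - x‖⁻¹) ≤ 1 := by
        rw [div_mul_eq_mul_div, div_le_one hsin, ← le_div_iff₀ (by positivity), div_eq_mul_inv]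
        exact hρr.le.trans hrε
      linarith
    have e1 : G !₂[ρ * Real.cos t, ρ * Real.sin t] = (1 - α - β) • x + α • y + β • z := by
      have e2 : (1 - α - β) • x + α • y + β • z = x + (α • (y - x) + β • (z - x)) := by module
      have e3 : α • (y - x) = (ρ * Real.sin (θ - t) / Real.sin θ) • e := by
        rw [he, hα, mul_smul]
      have e4 : β • (z - x) = (ρ * Real.sin t / Real.sin θ) • w := by
        rw [hw, hβ, mul_smul]
      rw [e2, e3, e4, hwe]
      change x + ((ρ * Real.cos t) • e + (ρ * Real.sin t) • n) = _
      have e5 : ρ * Real.cos t =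
          ρ * Real.sin (θ - t) / Real.sin θ + ρ * Real.sin t / Real.sin θ * Real.cos θ := by
        rw [Real.sin_sub]
        field_simp
        ring
      have e6 : ρ * Real.sin t = ρ * Real.sin t / Real.sin θ * Real.sin θ := by
        field_simp
      rw [smul_add, smul_smul, smul_smul, ← e6, e5]
      module
    rw [e1]
    have hs' := hF.sum_mem (t := Finset.univ) (w := ![1 - α - β, α, β])
      (z := ![x, y, z]) (by
        intro i _
        fin_cases i
        · simp; linarith
        · simpa using hα0
        · simpa using hβ0) (by
        simp [Fin.sum_univ_three]
        ring) (by
        intro i _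
        fin_cases i <;> assumption)
    simpa [Fin.sum_univ_three] using hs'
  · have e0 : G 0 = x := by simp [G]
    rw [Metric.mem_ball]
    conv_lhs => rw [← e0]
    rw [hG.dist_eq, dist_zero_right, EuclideanSpace.norm_eq, Fin.sum_univ_two]
    simp only [Real.norm_eq_abs, sq_abs]
    have : (ρ * Real.cos t) ^ 2 + (ρ * Real.sin t) ^ 2 = ρ ^ 2 := by
      linear_combination ρ ^ 2 * Real.sin_sq_add_cos_sq t
    change Real.sqrt ((ρ * Real.cos t) ^ 2 + (ρ * Real.sin t) ^ 2) < r
    rw [this, Real.sqrt_sq hρ0.le]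
    exact hρr

namespace Polytope

variable {Q : Polytope}

theorem convex_face (Q : Polytope) (u : E3) : Convex ℝ (Q.face u) :=
  (Q.isExposed_face u).convex (convex_convexHull ℝ _)

theorem isCompact_face (Q : Polytope) (u : E3) : IsCompact (Q.face u) :=
  (Q.isExposed_face u).isCompact Q.isCompact_carrier

theorem isClosed_face (Q : Polytope) (u : E3) : IsClosed (Q.face u) :=
  (Q.isCompact_face u).isClosed

/-- Isometric planar coordinates on a sheet. -/
theorem exists_chart {u : E3} (hu : u ∈ Q.sheets) : ∃ (ψ : E2 →ᵃⁱ[ℝ] E3) (F : Set E2),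
    Convex ℝ F ∧ IsClosed F ∧ (interior F).Nonempty ∧ ψ '' F = Q.face u ∧
      ψ '' interior F = intrinsicInterior ℝ (Q.face u) ∧
      ψ '' frontier F = intrinsicFrontier ℝ (Q.face u) := by
  have hne : (Q.face u).Nonempty := by
    by_contra h
    rw [not_nonempty_iff_eq_empty] at h
    have := hu.2
    rw [h, vectorSpan_empty, finrank_bot] at this
    omega
  obtain ⟨x, hx⟩ := hne
  set V := vectorSpan ℝ (Q.face u) with hV
  let ι : E2 ≃ₗᵢ[ℝ] V := ((stdOrthonormalBasis ℝ V).reindex (finCongr hu.2)).repr.symm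
  let ψ : E2 →ᵃⁱ[ℝ] E3 := (AffineIsometryEquiv.vaddConst ℝ x).toAffineIsometry.comp
    (V.subtypeₗᵢ.comp ι.toLinearIsometry).toAffineIsometry
  have hψ : ∀ p, ψ p = ι p + x := fun p => rfl
  have himg : ψ '' (ψ ⁻¹' Q.face u) = Q.face u := by
    rw [image_preimage_eq_iff]
    intro y hy
    refine ⟨ι.symm ⟨y - x, vsub_mem_vectorSpan ℝ hy hx⟩, ?_⟩
    rw [hψ, ι.apply_symm_apply]
    simp
  set F := ψ ⁻¹' Q.face u
  have hFc : Convex ℝ F := (Q.convex_face u).affine_preimage ψ.toAffineMap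
  have hFne : F.Nonempty := by
    rw [← himg] at hx
    exact hx.imp fun _ h => h.1
  have hvs : vectorSpan ℝ F = ⊤ := by
    apply Submodule.eq_top_of_finrank_eq
    rw [finrank_euclideanSpace_fin]
    refine le_antisymm ((Submodule.finrank_le _).trans_eq (finrank_euclideanSpace_fin)) ?_
    have h1 := AffineMap.map_vectorSpan (k := ℝ) ψ.toAffineMap (s := F)
    have h2 : ψ.toAffineMap '' F = Q.face u := himg
    rw [h2] at h1
    have h3 := hu.2
    rw [← h1] at h3
    exact h3.symm.trans_le (Submodule.finrank_map_le _ _)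
  have has : affineSpan ℝ F = ⊤ :=
    (AffineSubspace.affineSpan_eq_top_iff_vectorSpan_eq_top_of_nonempty ℝ E2 E2 hFne).2 hvs
  have hint := intrinsicInterior_eq_interior has
  have hcl : IsClosed F := (Q.isClosed_face u).preimage ψ.continuous
  have hI : ψ '' interior F = intrinsicInterior ℝ (Q.face u) := by
    rw [← himg, ← hint]
    exact (ψ.intrinsicInterior_image F).symm
  refine ⟨ψ, F, hFc, hcl, hFc.interior_nonempty_iff_affineSpan_eq_top.2 has, himg, hI, ?_⟩
  rw [hcl.frontier_eq, image_sdiff ψ.injective, hI, himg, ← intrinsicClosure_sdiff_intrinsicInterior,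
    intrinsicClosure_eq_closure, (Q.isClosed_face u).closure_eq]

theorem _root_.AffineIsometry.area_image_inter_ball (ψ : E2 →ᵃⁱ[ℝ] E3) (F : Set E2) (q : E2)
    (r : ℝ) : μH[2] (ψ '' F ∩ Metric.ball (ψ q) r) = μH[2] (F ∩ Metric.ball q r) := by
  rw [← image_inter_preimage, ψ.isometry.preimage_ball,
    ψ.isometry.hausdorffMeasure_image (Or.inl (by norm_num))]

theorem two_mul_area_face_inter_ball_le {u : E3} (hu : u ∈ Q.sheets) {y : E3} (hy : y ∈ Q.face u)
    (hyi : y ∉ intrinsicInterior ℝ (Q.face u)) (r : ℝ) :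
    2 * μH[2] (Q.face u ∩ Metric.ball y r) ≤ discArea r := by
  obtain ⟨ψ, F, hFc, hcl, hne, himg, hI, hB⟩ := exists_chart hu
  rw [← hI] at hyi
  rw [← himg] at hy ⊢
  obtain ⟨q, hq, rfl⟩ := hy
  rw [ψ.area_image_inter_ball]
  exact hFc.two_mul_area_inter_ball_le (fun h => hyi (mem_image_of_mem _ h)) r

theorem area_face_inter_ball_le {u : E3} (hu : u ∈ Q.sheets) {y : E3} (hy : y ∈ Q.face u)
    (r : ℝ) : μH[2] (Q.face u ∩ Metric.ball y r) ≤ discArea r := by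
  obtain ⟨ψ, F, hFc, hcl, hne, himg, hI, hB⟩ := exists_chart hu
  rw [← himg] at hy ⊢
  obtain ⟨q, hq, rfl⟩ := hy
  rw [ψ.area_image_inter_ball, ← hausdorffMeasure_ball q r]
  exact measure_mono inter_subset_right

theorem area_intrinsicFrontier_face {u : E3} (hu : u ∈ Q.sheets) :
    μH[2] (intrinsicFrontier ℝ (Q.face u)) = 0 := by
  obtain ⟨ψ, F, hFc, hcl, hne, himg, hI, hB⟩ := exists_chart hu
  rw [← hB, ψ.isometry.hausdorffMeasure_image (Or.inl (by norm_num)), hFc.addHaar_frontier μH[2]]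

/-- `faceAngle` is a supremum on the relative boundary, so the slack `δ` selects an actual pair of
points whose sector lies in the face. -/
theorem exists_faceAngle_le_area {u : E3} (hu : u ∈ Q.sheets) {y : E3} (hy : y ∈ Q.face u)
    {δ : ℝ} (hδ : 0 < δ) : ∃ ε > 0, ∀ r, 0 < r → r ≤ ε →
      ENNReal.ofReal ((faceAngle (Q.face u) y - δ) / (2 * Real.pi)) * discArea r ≤
        μH[2] (Q.face u ∩ Metric.ball y r) := by
  obtain ⟨ψ, F, hFc, hcl, hne, himg, hI, hB⟩ := exists_chart hu
  have hπ := Real.pi_pos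
  rw [← himg] at hy
  obtain ⟨q, hq, rfl⟩ := hy
  by_cases hyi : ψ q ∈ intrinsicInterior ℝ (Q.face u)
  · have hqi : q ∈ interior F := by
      rw [← hI] at hyi
      exact (ψ.injective.mem_set_image).1 hyi
    obtain ⟨ε, hε, hball⟩ := Metric.isOpen_iff.1 isOpen_interior q hqi
    refine ⟨ε, hε, fun r hr hrε => ?_⟩
    have h1 : ENNReal.ofReal ((faceAngle (Q.face u) (ψ q) - δ) / (2 * Real.pi)) ≤ 1 := by
      rw [faceAngle, if_pos hyi, ENNReal.ofReal_le_one, div_le_one (by positivity)]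
      linarith
    rw [← himg, ψ.area_image_inter_ball, inter_eq_right.2
      ((Metric.ball_subset_ball hrε).trans (hball.trans interior_subset)), hausdorffMeasure_ball]
    rw [himg]
    exact mul_le_of_le_one_left' h1
  · rw [faceAngle, if_neg hyi]
    set A := {θ : ℝ | ∃ y ∈ Q.face u, ∃ z ∈ Q.face u,
      y ≠ ψ q ∧ z ≠ ψ q ∧ θ = EuclideanGeometry.angle y (ψ q) z}
    rcases A.eq_empty_or_nonempty with hA | hA
    · refine ⟨1, one_pos, fun r _ _ => ?_⟩
      -- The supremum over the empty set is `0` by convention, so the left side vanishes.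
      rw [hA, Real.sSup_empty, ENNReal.ofReal_of_nonpos, zero_mul]
      · exact zero_le
      · exact div_nonpos_of_nonpos_of_nonneg (by linarith) (by positivity)
    obtain ⟨θ, ⟨y, hy, z, hz, hyq, hzq, rfl⟩, hθ⟩ :=
      exists_lt_of_lt_csSup hA (sub_lt_self (sSup A) hδ)
    rw [← himg] at hy hz
    obtain ⟨y, hy, rfl⟩ := hy
    obtain ⟨z, hz, rfl⟩ := hz
    obtain ⟨ε, hε, H⟩ := hFc.exists_angle_le_area_inter_ball hne hq hy hz
      (fun h => hyq (h ▸ rfl)) (fun h => hzq (h ▸ rfl))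
    refine ⟨ε, hε, fun r hr hrε => ?_⟩
    rw [← himg, ψ.area_image_inter_ball]
    refine le_trans (mul_le_mul_left (ENNReal.ofReal_le_ofReal ?_) _) (H r hr hrε)
    rw [ψ.angle_map] at hθ
    gcongr

theorem eq_or_eq_neg_of_face_subset {u v : E3} (hu : u ∈ Q.sheets) (hv : v ∈ Q.sheets)
    (h : Q.face u ⊆ Q.face v) : v = u ∨ v = -u := by
  have h1 : vectorSpan ℝ (Q.face u) = vectorSpan ℝ (Q.face v) :=
    Submodule.eq_of_le_of_finrank_eq (vectorSpan_mono ℝ h) (hu.2.trans hv.2.symm)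
  have hfr : Module.finrank ℝ (vectorSpan ℝ (Q.face u))ᗮ = 1 := by
    have h1 := (vectorSpan ℝ (Q.face u)).finrank_add_finrank_orthogonal
    rw [hu.2, finrank_euclideanSpace_fin] at h1
    omega
  have hu0 : u ≠ 0 := by
    rintro rfl
    simpa using hu.1
  obtain ⟨c, hc⟩ := exists_smul_eq_of_finrank_eq_one hfr
    (x := ⟨u, Q.mem_orthogonal_vectorSpan_face u⟩) (by simpa using hu0)
    ⟨v, h1 ▸ Q.mem_orthogonal_vectorSpan_face v⟩
  have hc' : c • u = v := congrArg Subtype.val hc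
  have hn : |c| = 1 := by
    have := hv.1
    rwa [← hc', norm_smul, hu.1, mul_one, Real.norm_eq_abs] at this
  rcases eq_or_eq_neg_of_abs_eq hn with rfl | rfl
  · left; simpa using hc'.symm
  · right; simpa using hc'.symm

theorem face_subset_of_mem_openSegment {v a b c : E3} (ha : a ∈ Q.carrier) (hb : b ∈ Q.carrier)
    (hc : c ∈ openSegment ℝ a b) (hcv : c ∈ Q.face v) : a ∈ Q.face v ∧ b ∈ Q.face v := by
  have := (Q.isExposed_face v).isExtreme
  exact ⟨this.2 ha hb hcv hc, this.2 hb ha hcv (openSegment_symm ℝ a b ▸ hc)⟩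

/-- Every segment from a point of the face of `u` to `z` can be prolonged beyond `z` inside that
face, so extremality of the face of `v` puts the whole face of `u` into it. Then `v = u` or `v =
-u`. -/
theorem face_eq_of_mem_intrinsicInterior {u v : E3} (hu : u ∈ Q.sheets) (hv : v ∈ Q.sheets)
    {z : E3} (hz : z ∈ intrinsicInterior ℝ (Q.face u)) (hzv : z ∈ Q.face v) :
    Q.face u = Q.face v := by
  have hsub : Q.face u ⊆ Q.face v := by
    intro y hy
    obtain ⟨ψ, F, hFc, hcl, hne, himg, hI, hB⟩ := exists_chart hu
    rw [← hI] at hz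
    obtain ⟨q, hq, rfl⟩ := hz
    have hy' := hy
    rw [← himg] at hy'
    obtain ⟨p, hp, rfl⟩ := hy'
    rcases eq_or_ne p q with rfl | hpq
    · exact hzv
    obtain ⟨ε, hε, hball⟩ := Metric.isOpen_iff.1 isOpen_interior q hq
    set t := ε / (2 * dist p q)
    have hd : 0 < dist p q := dist_pos.2 hpq
    have ht : 0 < t := by positivity
    have hmem : q + t • (q - p) ∈ F := by
      refine interior_subset (hball ?_)
      rw [mem_ball_iff_norm, add_sub_cancel_left, norm_smul, ← dist_eq_norm, dist_comm q p,
        Real.norm_of_nonneg ht.le]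
      simp only [t]
      field_simp
      linarith
    refine (face_subset_of_mem_openSegment (a := ψ p) (b := ψ (q + t • (q - p)))
      (c := ψ q) hy.1 ?_ ?_ hzv).1
    · exact (himg ▸ mem_image_of_mem ψ hmem : ψ (q + t • (q - p)) ∈ Q.face u).1
    · rw [← ψ.coe_toAffineMap, ← image_openSegment]
      refine mem_image_of_mem _ ⟨t / (1 + t), 1 / (1 + t), by positivity, by positivity, ?_, ?_⟩
      · field_simp
        ring
      · have : q = (1 / (1 + t) * (1 + t)) • q := by
          rw [one_div_mul_cancel (by positivity), one_smul]
        conv_rhs => rw [this]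
        module
  rcases eq_or_eq_neg_of_face_subset hu hv hsub with rfl | rfl
  · rfl
  -- The flat case: both extreme values of the functional `u` are attained at `z`, so it is constant
  -- on the polytope.
  · refine hsub.antisymm fun y hy => ⟨hy.1, fun w hw => ?_⟩
    have hzu := (intrinsicInterior_subset hz).2 w hw
    have h1 := hzv.2 y hy.1
    simp only [inner_neg_left] at h1
    linarith

/-! ### Surface points -/

theorem point_loc (u x : E3) : (Q.point u x).loc = x := rfl

/-- The incidence record of a relatively interior point admits only its own sheet; this separates
the two sides of a flat polytope. -/
theorem eq_of_mem_intrinsicInterior_of_point_eq {u v z : E3} (hv : v ∈ Q.sheets)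
    (hz : z ∈ intrinsicInterior ℝ (Q.face u)) (hzv : z ∈ Q.face v)
    (h : Q.point u z = Q.point v z) : v = u := by
  have : v ∈ (Q.point v z).incident := ⟨hv, hzv, Or.inl rfl⟩
  rw [← h] at this
  exact this.2.2.resolve_right (not_not_intro hz)

theorem point_eq_of_mem_incident {u v z : E3} (hu : u ∈ Q.sheets) (hz : z ∈ Q.face u)
    (hv : v ∈ (Q.point u z).incident) : Q.point v z = Q.point u z := by
  obtain ⟨hvs, hzv, rfl | h⟩ := hv
  · rfl
  have hzv : z ∈ Q.face v := hzv
  have h' : z ∉ intrinsicInterior ℝ (Q.face v) := fun hi =>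
    h (face_eq_of_mem_intrinsicInterior hvs hu hi hz ▸ hi)
  simp [point, h, h']

/-- Two different sheets are glued exactly along the intersection of their relative boundaries,
which is closed. -/
theorem isClosed_setOf_point_eq {u v : E3} (hu : u ∈ Q.sheets) (hv : v ∈ Q.sheets) :
    IsClosed {z | z ∈ Q.face u ∧ z ∈ Q.face v ∧ Q.point u z = Q.point v z} := by
  rcases eq_or_ne u v with rfl | huv
  · simpa using Q.isClosed_face u
  have hfr : ∀ w, intrinsicFrontier ℝ (Q.face w) = Q.face w \ intrinsicInterior ℝ (Q.face w) :=
    fun w => by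
      rw [← intrinsicClosure_sdiff_intrinsicInterior, intrinsicClosure_eq_closure,
        (Q.isClosed_face w).closure_eq]
  have hcl : ∀ w, IsClosed (intrinsicFrontier ℝ (Q.face w)) := fun w =>
    isClosed_intrinsicFrontier (AffineSubspace.closed_of_finiteDimensional _)
  convert (hcl u).inter (hcl v) using 1
  ext z
  rw [hfr, hfr]
  constructor
  · rintro ⟨h1, h2, h⟩
    exact ⟨⟨h1, fun hi => huv (eq_of_mem_intrinsicInterior_of_point_eq hv hi h2 h).symm⟩,
      ⟨h2, fun hi => huv (eq_of_mem_intrinsicInterior_of_point_eq hu hi h1 h.symm)⟩⟩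
  · rintro ⟨⟨h1, h1'⟩, h2, h2'⟩
    exact ⟨h1, h2, by simp [point, h1', h2']⟩

/-! ### Sheets along a segment -/

/-- Each `w i` is `k i` times `u i` turned by a right angle, and `k i * D i j ≤ 0` for the
determinants `D i j` of the normals. Two of the three numbers `k i` have the same sign. Antisymmetry
of `D` makes those two normals opposite, and then the third is opposite to the first, so it equals
the second. -/
theorem _root_.false_of_three_unit_normals {u w : Fin 3 → E2} (hu : ∀ i, ‖u i‖ = 1)
    (hinj : Function.Injective u) (hw : ∀ i, w i ≠ 0) (horth : ∀ i, ⟪u i, w i⟫ = 0)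
    (hle : ∀ i j, ⟪u j, w i⟫ ≤ 0) : False := by
  have hin : ∀ x y : E2, ⟪x, y⟫ = x 0 * y 0 + x 1 * y 1 := fun x y => by
    simp [PiLp.inner_apply, Fin.sum_univ_two, mul_comm]
  have hsq : ∀ i, u i 0 ^ 2 + u i 1 ^ 2 = 1 := fun i => by
    have := real_inner_self_eq_norm_sq (u i)
    rw [hu i, hin] at this
    linarith
  set k : Fin 3 → ℝ := fun i => u i 0 * w i 1 - u i 1 * w i 0 with hk
  set D : Fin 3 → Fin 3 → ℝ := fun i j => u i 0 * u j 1 - u i 1 * u j 0 with hD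
  have hw0 : ∀ i, w i 0 = -k i * u i 1 := fun i => by
    have h1 := horth i
    rw [hin] at h1
    simp only [hk]
    linear_combination (-w i 0) * hsq i + u i 0 * h1
  have hw1 : ∀ i, w i 1 = k i * u i 0 := fun i => by
    have h1 := horth i
    rw [hin] at h1
    simp only [hk]
    linear_combination (-w i 1) * hsq i + u i 1 * h1
  have hk0 : ∀ i, k i ≠ 0 := fun i h => hw i (by
    ext m
    fin_cases m
    · simp [hw0 i, h]
    · simp [hw1 i, h])
  have hkD : ∀ i j, k i * D i j ≤ 0 := fun i j => by
    have h1 := hle i j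
    rw [hin, hw0, hw1] at h1
    simp only [hD]
    linarith
  have hanti : ∀ i j, D j i = -D i j := fun i j => by simp only [hD]; ring
  have hD0 : ∀ i j, i ≠ j → D i j = 0 → u j = -u i := fun i j hij h => by
    set m := u i 0 * u j 0 + u i 1 * u j 1 with hm
    have e0 : u j 0 = m * u i 0 := by
      simp only [hD] at h
      linear_combination (-u j 0) * hsq i - u i 1 * h
    have e1 : u j 1 = m * u i 1 := by
      simp only [hD] at h
      linear_combination (-u j 1) * hsq i + u i 0 * h
    have hm2 : m ^ 2 = 1 := by
      have := hsq j
      rw [e0, e1] at this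
      linear_combination this - m ^ 2 * hsq i
    rcases mul_self_eq_one_iff.1 ((sq m).symm.trans hm2) with h1 | h1
    · refine absurd (hinj ?_) hij
      ext l
      fin_cases l
      · simp [e0, h1]
      · simp [e1, h1]
    · ext l
      fin_cases l
      · simp [e0, h1]
      · simp [e1, h1]
  have hz : ∀ i j l, 0 < k i * k j → D i l = -D j l → D i l = 0 := fun i j l hp h => by
    have h1 := hkD i l
    have h2 := hkD j l
    have h3 : D j l = -D i l := by linarith
    rw [h3] at h2
    rcases pos_and_pos_or_neg_and_neg_of_mul_pos hp with ⟨hi, hj⟩ | ⟨hi, hj⟩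
    · nlinarith
    · nlinarith
  have key : ∀ i j l, i ≠ j → i ≠ l → j ≠ l → 0 < k i * k j → False := fun i j l hij hil hjl hp => by
    have h1 : D i j = 0 := by
      have h1 := hkD i j
      have h2 := hkD j i
      rw [hanti i j] at h2
      rcases pos_and_pos_or_neg_and_neg_of_mul_pos hp with ⟨hi, hj⟩ | ⟨hi, hj⟩
      · nlinarith
      · nlinarith
    have h2 := hD0 i j hij h1
    have h3 : D i l = -D j l := by
      simp only [hD, h2, PiLp.neg_apply]
      ring
    have h4 := hD0 i l hil (hz i j l hp h3)
    exact hjl (hinj (h2.trans h4.symm))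
  have h01 := key 0 1 2 (by decide) (by decide) (by decide)
  have h02 := key 0 2 1 (by decide) (by decide) (by decide)
  have h12 := key 1 2 0 (by decide) (by decide) (by decide)
  rcases (hk0 0).lt_or_gt with a | a <;> rcases (hk0 1).lt_or_gt with b | b <;>
    rcases (hk0 2).lt_or_gt with c | c <;>
    first
    | exact h01 (mul_pos_of_neg_of_neg a b)
    | exact h01 (mul_pos a b)
    | exact h02 (mul_pos_of_neg_of_neg a c)
    | exact h02 (mul_pos a c)
    | exact h12 (mul_pos_of_neg_of_neg b c)
    | exact h12 (mul_pos b c)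

/-- Projecting along `b - a` turns three sheets through `a` and `b` into three supporting
half-planes at one point, each with a nonzero direction of its face on its boundary line. -/
theorem ncard_sheets_le_two {a b : E3} (hab : a ≠ b) :
    {u | u ∈ Q.sheets ∧ a ∈ Q.face u ∧ b ∈ Q.face u}.ncard ≤ 2 := by
  by_contra! h
  obtain ⟨u₀, u₁, u₂, hu₀, hu₁, hu₂, h01, h02, h12⟩ :=
    (Set.two_lt_ncard_iff (Q.finite_sheets.subset fun u hu => hu.1)).1 h
  set e := b - a
  have he : e ≠ 0 := sub_ne_zero.2 hab.symm
  set V : Submodule ℝ E3 := (Submodule.span ℝ {e})ᗮ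
  have hV : Module.finrank ℝ V = 2 := by
    have h1 := (Submodule.span ℝ {e}).finrank_add_finrank_orthogonal
    rw [finrank_span_singleton he, finrank_euclideanSpace_fin] at h1
    exact Nat.add_left_cancel h1
  let ι : V ≃ₗᵢ[ℝ] E2 := ((stdOrthonormalBasis ℝ V).reindex (finCongr hV)).repr
  let u : Fin 3 → E3 := ![u₀, u₁, u₂]
  have hu : ∀ i, u i ∈ Q.sheets ∧ a ∈ Q.face (u i) ∧ b ∈ Q.face (u i) := fun i => by
    fin_cases i <;> assumption
  have huinj : Function.Injective u := by
    intro i j hij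
    fin_cases i <;> fin_cases j <;> simp_all [u]
  have huV : ∀ i, u i ∈ V := fun i => by
    rw [Submodule.mem_orthogonal_singleton_iff_inner_left, inner_sub_right]
    linarith [(hu i).2.1.2 b (hu i).2.2.1, (hu i).2.2.2 a (hu i).2.1.1]
  have ht : ∀ i, ∃ t ∈ Q.face (u i), t - a ∉ Submodule.span ℝ {e} := fun i => by
    by_contra! hcon
    have h1 : vectorSpan ℝ (Q.face (u i)) ≤ Submodule.span ℝ {e} := by
      rw [vectorSpan_eq_span_vsub_set_right ℝ (hu i).2.1, Submodule.span_le]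
      rintro _ ⟨t, ht, rfl⟩
      exact hcon t ht
    have h2 := Submodule.finrank_mono h1
    rw [finrank_span_singleton he, (hu i).1.2] at h2
    omega
  choose t htf hte using ht
  have hin : ∀ i j, ⟪ι ⟨u j, huV j⟩, ι (V.orthogonalProjectionOnto (t i - a))⟫ = ⟪u j, t i - a⟫ :=
    fun i j => by
      rw [ι.inner_map_map]
      exact Submodule.inner_orthogonalProjectionOnto_eq_of_mem_left ⟨u j, huV j⟩ (t i - a)
  refine false_of_three_unit_normals (u := fun i => ι ⟨u i, huV i⟩)
    (w := fun i => ι (V.orthogonalProjectionOnto (t i - a))) ?_ ?_ ?_ ?_ ?_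
  · intro i
    rw [ι.norm_map]
    exact (hu i).1.1
  · intro i j hij
    exact huinj (congrArg Subtype.val (ι.injective hij))
  · intro i h0
    rw [map_eq_zero_iff _ ι.injective, Submodule.orthogonalProjectionOnto_eq_zero_iff,
      Submodule.orthogonal_orthogonal] at h0
    exact hte i h0
  · intro i
    rw [hin, inner_sub_right]
    linarith [(hu i).2.1.2 (t i) (htf i).1, (htf i).2 a (hu i).2.1.1]
  · intro i j
    rw [hin, inner_sub_right]
    linarith [(hu j).2.1.2 (t i) (htf i).1]

end Polytope

/-! ### ### Uniform radii for finite families, and area of segments -/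

theorem exists_pos_forall_le {ι : Type*} [Finite ι] {ε : ι → ℝ} (hε : ∀ i, 0 < ε i) :
    ∃ δ > 0, ∀ i, δ ≤ ε i := by
  have h : ∀ᶠ δ in nhdsWithin (0 : ℝ) (Ioi 0), ∀ i, δ ∈ Ioc 0 (ε i) :=
    Filter.eventually_all.2 fun i => Ioc_mem_nhdsGT (hε i)
  obtain ⟨δ, h1, h2⟩ := (h.and self_mem_nhdsWithin).exists
  exact ⟨δ, h2, fun i => (h1 i).2⟩

theorem Metric.exists_pos_forall_mem_of_isClosed {X ι : Type*} [PseudoMetricSpace X] [Finite ι]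
    {A : ι → Set X} (hA : ∀ i, IsClosed (A i)) (p : X) :
    ∃ ε > 0, ∀ i, ∀ q ∈ A i, dist q p < ε → p ∈ A i := by
  have : ∀ i, ∃ ε > 0, ∀ q ∈ A i, dist q p < ε → p ∈ A i := fun i => by
    by_cases hp : p ∈ A i
    · exact ⟨1, one_pos, fun _ _ _ => hp⟩
    · obtain ⟨ε, hε, h⟩ := Metric.isOpen_iff.1 (hA i).isOpen_compl p hp
      exact ⟨ε, hε, fun q hq hqp => absurd hq (h hqp)⟩
  choose ε hε h using this
  obtain ⟨δ, hδ, hle⟩ := exists_pos_forall_le hε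
  exact ⟨δ, hδ, fun i q hq hqp => h i q hq (hqp.trans_le (hle i))⟩

theorem hausdorffMeasure_two_segment (a b : E3) : μH[2] (segment ℝ a b) = 0 := by
  refine (Measure.hausdorffMeasure_zero_or_top (show (1 : ℝ) < 2 by norm_num) _).resolve_right ?_
  rw [hausdorffMeasure_segment]
  exact edist_ne_top _ _

namespace Polytope

variable {Q : Polytope}

theorem finite_incident {p : SurfacePoint} (hp : p ∈ Q.surface) : p.incident.Finite := by
  obtain ⟨u, hu, x, hx, rfl⟩ := hp
  exact Q.finite_sheets.subset fun v hv => hv.1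

theorem incident_subset {p : SurfacePoint} (hp : p ∈ Q.surface) {v : E3} (hv : v ∈ p.incident) :
    v ∈ Q.sheets ∧ p.loc ∈ Q.face v ∧ Q.point v p.loc = p := by
  obtain ⟨u, hu, x, hx, rfl⟩ := hp
  exact ⟨hv.1, hv.2.1, point_eq_of_mem_incident hu hx hv⟩

/-- Around a point in the interior of a segment on a sheet, the area of the surface is at most that
of a disc. -/
theorem sum_area_le_discArea {u a b c : E3} (hu : u ∈ Q.sheets) (ha : a ∈ Q.face u)
    (hb : b ∈ Q.face u) (hab : a ≠ b) (hc : c ∈ openSegment ℝ a b)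
    (hfin : (Q.point u c).incident.Finite) (r : ℝ) :
    ∑ v ∈ hfin.toFinset, μH[2] (Q.face v ∩ Metric.ball c r) ≤ discArea r := by
  have hcu : c ∈ Q.face u := (Q.convex_face u).openSegment_subset ha hb hc
  by_cases hi : c ∈ intrinsicInterior ℝ (Q.face u)
  · calc ∑ v ∈ hfin.toFinset, μH[2] (Q.face v ∩ Metric.ball c r)
        ≤ ∑ v ∈ {u}, μH[2] (Q.face v ∩ Metric.ball c r) := by
          refine Finset.sum_le_sum_of_subset fun v hv => ?_
          rw [Finite.mem_toFinset] at hv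
          exact Finset.mem_singleton.2 (hv.2.2.resolve_right (not_not_intro hi))
      _ ≤ discArea r := by
          rw [Finset.sum_singleton]
          exact area_face_inter_ball_le hu hcu r
  -- On the relative boundary, every sheet at `c` contains both ends `a` and `b` because faces are
  -- extreme. So there are at most two sheets, each with at most half a disc.
  · have hcard : hfin.toFinset.card ≤ 2 := by
      rw [← ncard_eq_toFinset_card _ hfin]
      refine le_trans (ncard_le_ncard (fun v hv => ?_) (Q.finite_sheets.subset fun v hv => hv.1))
        (Q.ncard_sheets_le_two hab)
      exact ⟨hv.1, face_subset_of_mem_openSegment ha.1 hb.1 hc hv.2.1⟩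
    have h2 : 2 * ∑ v ∈ hfin.toFinset, μH[2] (Q.face v ∩ Metric.ball c r) ≤ 2 * discArea r := by
      calc 2 * ∑ v ∈ hfin.toFinset, μH[2] (Q.face v ∩ Metric.ball c r)
          = ∑ v ∈ hfin.toFinset, 2 * μH[2] (Q.face v ∩ Metric.ball c r) := Finset.mul_sum ..
        _ ≤ ∑ v ∈ hfin.toFinset, discArea r := by
            refine Finset.sum_le_sum fun v hv => ?_
            rw [Finite.mem_toFinset] at hv
            refine two_mul_area_face_inter_ball_le hv.1 hv.2.1 (fun h => hi ?_) r
            exact face_eq_of_mem_intrinsicInterior hv.1 hu h hcu ▸ h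
        _ = hfin.toFinset.card * discArea r := by rw [Finset.sum_const, nsmul_eq_mul]
        _ ≤ 2 * discArea r := by gcongr; exact_mod_cast hcard
    exact (ENNReal.mul_le_mul_iff_right (by norm_num) (by norm_num)).1 h2

/-! ### Piecewise isometric maps to the surface -/

/-- A finite closed cover of `P` by sets that are carried isometrically into sheets. -/
structure IsometricCover (Q : Polytope) (P : Set E2) (f : E2 → SurfacePoint) where
  size : ℕ
  piece : Fin size → Set E2
  sheet : Fin size → E3
  isCompact_piece : ∀ k, IsCompact (piece k)
  eq_iUnion : P = ⋃ k, piece k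
  sheet_mem : ∀ k, sheet k ∈ Q.sheets
  dist_loc : ∀ k, ∀ x ∈ piece k, ∀ y ∈ piece k, dist (f x).loc (f y).loc = dist x y
  loc_mem : ∀ k, ∀ x ∈ piece k, (f x).loc ∈ Q.face (sheet k)
  apply_eq : ∀ k, ∀ x ∈ piece k, f x = Q.point (sheet k) (f x).loc

theorem IsFolding.nonempty_isometricCover {T : Q.GeometricTree} {P : Set E2}
    {f : E2 → SurfacePoint} (hf : Q.IsFolding T P f) : Nonempty (Q.IsometricCover P f) := by
  obtain ⟨m, piece, sheet, φ, hP, h⟩ := hf.piecewise_isometric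
  have hloc : ∀ k, ∀ x ∈ convexHull ℝ (piece k : Set E2), (f x).loc = φ k x := fun k x hx => by
    rw [((h k).2.2 x hx).2, point_loc]
  exact ⟨{
    size := m
    piece := fun k => convexHull ℝ (piece k : Set E2)
    sheet := sheet
    isCompact_piece := fun k => (piece k).finite_toSet.isCompact_convexHull (𝕜 := ℝ)
    eq_iUnion := hP
    sheet_mem := fun k => (h k).1
    dist_loc := fun k x hx y hy => by rw [hloc k x hx, hloc k y hy, (h k).2.1 x hx y hy]
    loc_mem := fun k x hx => by rw [hloc k x hx]; exact ((h k).2.2 x hx).1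
    apply_eq := fun k x hx => by rw [hloc k x hx]; exact ((h k).2.2 x hx).2 }⟩

namespace IsometricCover

variable {P : Set E2} {f : E2 → SurfacePoint}

theorem exists_piece (S : Q.IsometricCover P f) {q : E2} (hq : q ∈ P) : ∃ k, q ∈ S.piece k := by
  rw [S.eq_iUnion] at hq
  exact mem_iUnion.1 hq

theorem piece_subset (S : Q.IsometricCover P f) (k : Fin S.size) : S.piece k ⊆ P :=
  fun _ hq => S.eq_iUnion.symm ▸ mem_iUnion.2 ⟨k, hq⟩

theorem mem_surface (S : Q.IsometricCover P f) {q : E2} (hq : q ∈ P) : f q ∈ Q.surface := by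
  obtain ⟨k, hk⟩ := S.exists_piece hq
  exact ⟨S.sheet k, S.sheet_mem k, _, S.loc_mem k q hk, S.apply_eq k q hk⟩

theorem sheet_mem_incident (S : Q.IsometricCover P f) {k : Fin S.size} {q : E2} (hq : q ∈ S.piece k) :
    S.sheet k ∈ (f q).incident := by
  rw [S.apply_eq k q hq]
  exact ⟨S.sheet_mem k, S.loc_mem k q hq, Or.inl rfl⟩

theorem continuousOn_loc (S : Q.IsometricCover P f) (k : Fin S.size) :
    ContinuousOn (fun q => (f q).loc) (S.piece k) := by
  refine LipschitzOnWith.continuousOn (K := 1) (LipschitzOnWith.of_dist_le_mul fun x hx y hy => ?_)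
  simpa using (S.dist_loc k x hx y hy).le

theorem exists_forall_mem_piece (S : Q.IsometricCover P f) (p : E2) : ∃ ε > 0, ∀ k, ∀ q ∈ S.piece k, dist q p < ε →
    p ∈ S.piece k :=
  Metric.exists_pos_forall_mem_of_isClosed (fun k => (S.isCompact_piece k).isClosed) p

theorem area_image_le (S : Q.IsometricCover P f) {D : Set E2} (hD : D ⊆ P) :
    μH[2] ((fun q => (f q).loc) '' D) ≤ μH[2] D :=
  hausdorffMeasure_image_le_of_cover _ S.piece (fun k => (S.isCompact_piece k).measurableSet)
    (S.eq_iUnion ▸ hD) fun k x hx y hy => (S.dist_loc k x hx.1 y hy.1).le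

/-- The inverse on `D` is an isometry on the image of each piece; these images are Borel as
injective continuous images of Borel sets. -/
theorem le_area_image (S : Q.IsometricCover P f) {D : Set E2} (hD : D ⊆ P)
    (hm : MeasurableSet D) (hinj : InjOn (fun q => (f q).loc) D) : μH[2] D ≤ μH[2] ((fun q => (f q).loc) '' D) := by
  set g : E2 → E3 := fun q => (f q).loc with hg
  have hleft := hinj.leftInvOn_invFunOn
  have himg : Function.invFunOn g D '' (g '' D) = D := by
    rw [image_image]
    exact (image_congr hleft).trans (image_id _)
  conv_lhs => rw [← himg]
  refine hausdorffMeasure_image_le_of_cover _ (fun k => g '' (D ∩ S.piece k)) (fun k => ?_) ?_ ?_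
  · exact (hm.inter (S.isCompact_piece k).measurableSet).image_of_continuousOn_injOn
      ((S.continuousOn_loc k).mono inter_subset_right) (hinj.mono inter_subset_left)
  · rintro _ ⟨q, hq, rfl⟩
    obtain ⟨k, hk⟩ := S.exists_piece (hD hq)
    exact mem_iUnion.2 ⟨k, q, ⟨hq, hk⟩, rfl⟩
  · rintro k _ ⟨⟨x, hx, rfl⟩, -⟩ _ ⟨⟨y, hy, rfl⟩, -⟩
    rw [hleft hx.1, hleft hy.1]
    exact (S.dist_loc k x hx.2 y hy.2).ge

/-- If `f` is injective on the interior of `P`, the areas near preimages of a surface point add up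
to at most the area of the surface near this point. -/
theorem exists_sum_area_le (S : Q.IsometricCover P f) (hP : Convex ℝ P)
    (hinj : InjOn f (interior P)) {y : SurfacePoint}
    (hfin : y.incident.Finite) {Z : Finset E2} (hZ : ∀ q ∈ Z, q ∈ P ∧ f q = y) :
    ∃ ε > 0, ∀ r ≤ ε, ∑ q ∈ Z, μH[2] (P ∩ Metric.ball q r) ≤
      ∑ u ∈ hfin.toFinset, μH[2] (Q.face u ∩ Metric.ball y.loc r) := by
  classical
  have h1 : ∀ q : Z, ∃ ε > 0, ∀ k, ∀ w ∈ S.piece k, dist w q < ε → (q : E2) ∈ S.piece k :=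
    fun q => S.exists_forall_mem_piece q
  choose ε₁ hε₁ H₁ using h1
  obtain ⟨δ₁, hδ₁, H₂⟩ := exists_pos_forall_le hε₁
  obtain ⟨δ₂, hδ₂, H₃⟩ := exists_pos_forall_le (ι := {a : Z × Z // a.1 ≠ a.2})
    (ε := fun a => dist (a.1.1 : E2) a.1.2 / 2)
    fun a => half_pos (dist_pos.2 fun h => a.2 (Subtype.ext h))
  refine ⟨min δ₁ δ₂, lt_min hδ₁ hδ₂, fun r hr => ?_⟩
  rw [le_min_iff] at hr
  -- Passing to the interior, where `f` is injective, loses only the null frontier; the balls are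
  -- disjoint for small `r`.
  set W : Set E2 := ⋃ q ∈ Z, interior P ∩ Metric.ball q r with hW
  have hWP : W ⊆ interior P := iUnion₂_subset fun q _ => inter_subset_left
  have hWo : IsOpen W := isOpen_biUnion fun q _ => isOpen_interior.inter Metric.isOpen_ball
  set E : E3 → Set E2 := fun u => W ∩ ⋃ k ∈ {k | S.sheet k = u}, S.piece k with hE
  have hloc : ∀ w ∈ W, ∀ k, w ∈ S.piece k → S.sheet k ∈ y.incident ∧ dist (f w).loc y.loc < r := by
    intro w hw k hk
    obtain ⟨q, hq, hw⟩ := mem_iUnion₂.1 hw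
    have hqk := H₁ ⟨q, hq⟩ k w hk (lt_of_lt_of_le hw.2 (hr.1.trans (H₂ ⟨q, hq⟩)))
    rw [← (hZ q hq).2]
    exact ⟨S.sheet_mem_incident hqk, (S.dist_loc k w hk q hqk).trans_lt hw.2⟩
  calc ∑ q ∈ Z, μH[2] (P ∩ Metric.ball q r)
      ≤ ∑ q ∈ Z, μH[2] (interior P ∩ Metric.ball q r) := by
        refine Finset.sum_le_sum fun q _ => ?_
        calc μH[2] (P ∩ Metric.ball q r)
            ≤ μH[2] ((interior P ∩ Metric.ball q r) ∪ frontier P) := by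
              refine measure_mono fun z hz => ?_
              by_cases h : z ∈ interior P
              · exact Or.inl ⟨h, hz.2⟩
              · exact Or.inr ⟨subset_closure hz.1, h⟩
          _ ≤ _ := measure_union_le _ _
          _ = _ := by rw [hP.addHaar_frontier μH[2], add_zero]
    _ = μH[2] W := by
        rw [hW, measure_biUnion_finset]
        · intro q hq q' hq' hne
          refine Disjoint.mono inter_subset_right inter_subset_right (Metric.ball_disjoint_ball ?_)
          have := H₃ ⟨(⟨q, hq⟩, ⟨q', hq'⟩), fun h => hne (congrArg Subtype.val h)⟩
          simp only at this
          linarith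
        · exact fun q _ => (isOpen_interior.inter Metric.isOpen_ball).measurableSet
    _ ≤ μH[2] (⋃ u ∈ hfin.toFinset, E u) := by
        refine measure_mono fun w hw => ?_
        obtain ⟨k, hk⟩ := S.exists_piece (interior_subset (hWP hw))
        exact mem_iUnion₂.2 ⟨S.sheet k, hfin.mem_toFinset.2 (hloc w hw k hk).1, hw,
          mem_iUnion₂.2 ⟨k, rfl, hk⟩⟩
    _ ≤ ∑ u ∈ hfin.toFinset, μH[2] (E u) := measure_biUnion_finset_le _ _
    _ ≤ ∑ u ∈ hfin.toFinset, μH[2] (Q.face u ∩ Metric.ball y.loc r) := by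
        refine Finset.sum_le_sum fun u _ => ?_
        refine (S.le_area_image (D := E u) (inter_subset_left.trans (hWP.trans interior_subset))
          ?_ ?_).trans (measure_mono ?_)
        · exact hWo.measurableSet.inter (Finite.measurableSet_biUnion (toFinite _)
            fun k _ => (S.isCompact_piece k).measurableSet)
        -- On one sheet the location determines the surface point, so injectivity of `f` passes to
        -- locations.
        · rintro w ⟨hw, hwu⟩ w' ⟨hw', hwu'⟩ h
          obtain ⟨k, rfl, hk⟩ := mem_iUnion₂.1 hwu
          obtain ⟨l, hl, hkl⟩ := mem_iUnion₂.1 hwu'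
          refine hinj (hWP hw) (hWP hw') ?_
          have h : (f w).loc = (f w').loc := h
          rw [S.apply_eq k w hk, S.apply_eq l w' hkl, hl, h]
        · rintro _ ⟨w, ⟨hw, hwu⟩, rfl⟩
          obtain ⟨k, rfl, hk⟩ := mem_iUnion₂.1 hwu
          exact ⟨S.loc_mem k w hk, (hloc w hw k hk).2⟩

/-- If `x` has a unique preimage `p`, the area of the surface near `x` is at most the area
of `P` near `p`. -/
theorem exists_sum_area_face_le (S : Q.IsometricCover P f) {N : Set SurfacePoint}
    (hsurj : Q.surface \ N ⊆ f '' P)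
    (hN : ∀ u ∈ Q.sheets, μH[2] {z | z ∈ Q.face u ∧ Q.point u z ∈ N} = 0) {p : E2}
    (hp : p ∈ P) (huniq : ∀ q ∈ P, f q = f p → q = p) (hfin : (f p).incident.Finite) :
    ∃ ε > 0, ∀ r ≤ ε, ∑ u ∈ hfin.toFinset, μH[2] (Q.face u ∩ Metric.ball (f p).loc r) ≤
      μH[2] (P ∩ Metric.ball p r) := by
  classical
  set g : E2 → E3 := fun q => (f q).loc with hg
  have hinc : ∀ u ∈ (f p).incident, _ := fun u hu => incident_subset (S.mem_surface hp) hu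
  -- The part of a piece whose surface points also lie on the sheet `u` has compact image. If this
  -- image comes close enough to the location of `f p`, it contains it, and uniqueness of the
  -- preimage puts `p` into the piece.
  set K : Fin S.size × hfin.toFinset → Set E2 := fun a =>
    {q | q ∈ S.piece a.1 ∧ g q ∈ {z | z ∈ Q.face (S.sheet a.1) ∧ z ∈ Q.face a.2 ∧
      Q.point (S.sheet a.1) z = Q.point a.2 z}} with hK
  have hKc : ∀ a, IsCompact (g '' K a) := fun a => by
    refine IsCompact.image_of_continuousOn ?_
      ((S.continuousOn_loc a.1).mono fun q hq => hq.1)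
    refine (S.isCompact_piece a.1).of_isClosed_subset ?_ fun q hq => hq.1
    exact (S.continuousOn_loc a.1).preimage_isClosed_of_isClosed (S.isCompact_piece a.1).isClosed
      (isClosed_setOf_point_eq (S.sheet_mem a.1) (hinc a.2 (hfin.mem_toFinset.1 a.2.2)).1)
  obtain ⟨ε, hε, H⟩ := Metric.exists_pos_forall_mem_of_isClosed (fun a => (hKc a).isClosed) (g p)
  have hnear : ∀ u ∈ (f p).incident, ∀ k, ∀ q ∈ S.piece k, g q ∈ Q.face u → f q = Q.point u (g q) →
      dist (g q) (g p) < ε → p ∈ S.piece k := by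
    intro u hu k q hq hqu hfq hd
    obtain ⟨q', hq', hqp⟩ := H (k, ⟨u, hfin.mem_toFinset.2 hu⟩) (g q)
      ⟨q, ⟨hq, S.loc_mem k q hq, hqu, (S.apply_eq k q hq).symm.trans hfq⟩, rfl⟩ hd
    have h1 : f q' = f p := by
      rw [S.apply_eq k q' hq'.1]
      refine hq'.2.2.2.trans ?_
      rw [hqp]
      exact (hinc u hu).2.2
    exact huniq q' (S.piece_subset k hq'.1) h1 ▸ hq'.1
  refine ⟨ε, hε, fun r hr => ?_⟩
  -- Points going to the relative boundary of a face are removed so that the sets `D u` of different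
  -- sheets are disjoint.
  set D : E3 → Set E2 := fun u => (⋃ k ∈ {k | S.sheet k = u}, S.piece k \
    (S.piece k ∩ g ⁻¹' intrinsicFrontier ℝ (Q.face u))) ∩ Metric.ball p r with hD
  have hfr : ∀ u, IsClosed (intrinsicFrontier ℝ (Q.face u)) := fun u =>
    isClosed_intrinsicFrontier (AffineSubspace.closed_of_finiteDimensional _)
  have hDm : ∀ u, MeasurableSet (D u) := fun u => by
    refine MeasurableSet.inter (Finite.measurableSet_biUnion (toFinite _) fun k _ => ?_)
      Metric.isOpen_ball.measurableSet
    refine (S.isCompact_piece k).measurableSet.diff (IsClosed.measurableSet ?_)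
    exact (S.continuousOn_loc k).preimage_isClosed_of_isClosed (S.isCompact_piece k).isClosed (hfr u)
  have hDP : ∀ u, D u ⊆ P ∩ Metric.ball p r := fun u q hq => by
    obtain ⟨k, -, hk⟩ := mem_iUnion₂.1 hq.1
    exact ⟨S.piece_subset k hk.1, hq.2⟩
  have hface : ∀ u, ∀ z ∈ Q.face u, z ∉ intrinsicFrontier ℝ (Q.face u) →
      z ∈ intrinsicInterior ℝ (Q.face u) := fun u z hz h => by
    have := subset_intrinsicClosure (𝕜 := ℝ) hz
    rw [← intrinsicInterior_union_intrinsicFrontier] at this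
    exact this.resolve_right h
  calc ∑ u ∈ hfin.toFinset, μH[2] (Q.face u ∩ Metric.ball (g p) r)
      ≤ ∑ u ∈ hfin.toFinset, μH[2] (D u) := by
        refine Finset.sum_le_sum fun u hu => ?_
        rw [hfin.mem_toFinset] at hu
        have hus := (hinc u hu).1
        calc μH[2] (Q.face u ∩ Metric.ball (g p) r)
            ≤ μH[2] (g '' D u ∪ (intrinsicFrontier ℝ (Q.face u) ∪
                {z | z ∈ Q.face u ∧ Q.point u z ∈ N})) := by
              refine measure_mono fun z hz => ?_
              by_contra hcon
              simp only [mem_union, not_or] at hcon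
              obtain ⟨hc1, hc2, hc3⟩ := hcon
              have hzi := hface u z hz.1 hc2
              obtain ⟨q, hqP, hq⟩ := hsurj (show Q.point u z ∈ Q.surface \ N from
                ⟨⟨u, hus, z, hz.1, rfl⟩, fun h => hc3 ⟨hz.1, h⟩⟩)
              have hgq : g q = z := by simp only [hg, hq, point_loc]
              obtain ⟨k, hk⟩ := S.exists_piece hqP
              have hdist : dist (g q) (g p) < r := hgq ▸ hz.2
              have hpk := hnear u hu k q hk (hgq ▸ hz.1) (by rw [hgq, hq]) (hdist.trans_le hr)
              have hsk : S.sheet k = u := by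
                refine eq_of_mem_intrinsicInterior_of_point_eq (S.sheet_mem k) hzi
                  (hgq ▸ S.loc_mem k q hk) ?_
                rw [← hq, S.apply_eq k q hk]
                exact congrArg _ hgq
              refine hc1 ⟨q, ⟨mem_iUnion₂.2 ⟨k, hsk, hk, fun h => hc2 ?_⟩, ?_⟩, hgq⟩
              · rw [← hgq]
                exact h.2
              · rw [Metric.mem_ball, ← S.dist_loc k q hk p hpk]
                exact hdist
          _ ≤ μH[2] (g '' D u) + (μH[2] (intrinsicFrontier ℝ (Q.face u)) +
                μH[2] {z | z ∈ Q.face u ∧ Q.point u z ∈ N}) :=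
              (measure_union_le _ _).trans (add_le_add le_rfl (measure_union_le _ _))
          _ = μH[2] (g '' D u) := by
              rw [area_intrinsicFrontier_face hus, hN u hus, add_zero, add_zero]
          _ ≤ μH[2] (D u) := S.area_image_le ((hDP u).trans inter_subset_left)
    _ = μH[2] (⋃ u ∈ hfin.toFinset, D u) := by
        refine (measure_biUnion_finset ?_ fun u _ => hDm u).symm
        intro u hu v hv huv
        refine Set.disjoint_left.2 fun q hqu hqv => huv ?_
        obtain ⟨k, hku, hk, hk'⟩ := mem_iUnion₂.1 hqu.1
        obtain ⟨l, hlv, hl, -⟩ := mem_iUnion₂.1 hqv.1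
        simp only [mem_ofPred_eq] at hku hlv
        have hzu : g q ∈ Q.face u := hku ▸ S.loc_mem k q hk
        have hzv : g q ∈ Q.face v := hlv ▸ S.loc_mem l q hl
        have hvs : v ∈ Q.sheets := hlv ▸ S.sheet_mem l
        refine (eq_of_mem_intrinsicInterior_of_point_eq hvs
          (hface u _ hzu fun h => hk' ⟨hk, h⟩) hzv ?_).symm
        rw [← hku, ← hlv]
        exact (S.apply_eq k q hk).symm.trans (S.apply_eq l q hl)
    _ ≤ μH[2] (P ∩ Metric.ball p r) := measure_mono (iUnion₂_subset fun u _ => hDP u)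

end IsometricCover

end Polytope

namespace Polytope

variable {Q : Polytope}

/-! ### The cut tree -/

namespace GeometricTree

theorem segment_subset_face (T : Q.GeometricTree) {i j : Fin T.size} (h : T.graph.Adj i j) :
    segment ℝ (T.node i).loc (T.node j).loc ⊆ Q.face (T.sheet i j) := by
  have h2 := (T.node_mem_sheet j i h.symm).1
  rw [T.sheet_symm] at h2
  exact (Q.convex_face _).segment_subset (T.node_mem_sheet i j h).1 h2

theorem node_mem_segmentOn (T : Q.GeometricTree) {i j : Fin T.size} (h : T.graph.Adj i j) :
    T.node i ∈ Q.segmentOn (T.sheet i j) (T.node i) (T.node j) :=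
  ⟨_, left_mem_segment ℝ _ _, (T.node_mem_sheet i j h).2⟩

theorem segmentOn_symm (T : Q.GeometricTree) (i j : Fin T.size) :
    Q.segmentOn (T.sheet i j) (T.node i) (T.node j) =
      Q.segmentOn (T.sheet j i) (T.node j) (T.node i) := by
  rw [segmentOn, segmentOn, T.sheet_symm, segment_symm]

/-- Different surface points may share a location on a flat polytope, but not on a common sheet. -/
theorem loc_node_ne (T : Q.GeometricTree) {i j : Fin T.size} (h : T.graph.Adj i j) :
    (T.node i).loc ≠ (T.node j).loc := fun hloc => by
  have h1 := (T.node_mem_sheet i j h).2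
  have h2 := (T.node_mem_sheet j i h.symm).2
  rw [T.sheet_symm, ← hloc, h1] at h2
  exact h.ne (T.node_injective h2)

/-- The tree has area zero. -/
theorem area_support (T : Q.GeometricTree) (u : E3) :
    μH[2] {z | z ∈ Q.face u ∧ Q.point u z ∈ T.support} = 0 := by
  refine measure_mono_null (t := (⋃ i, {(T.node i).loc}) ∪
    ⋃ i, ⋃ j, segment ℝ (T.node i).loc (T.node j).loc) ?_ ?_
  · rintro z ⟨-, ⟨i, hi⟩ | ⟨i, j, -, w, hw, hwz⟩⟩
    · exact Or.inl (mem_iUnion.2 ⟨i, by rw [hi]; rfl⟩)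
    · have : w = z := congrArg SurfacePoint.loc hwz
      exact Or.inr (mem_iUnion₂.2 ⟨i, j, this ▸ hw⟩)
  · rw [measure_union_null_iff, measure_iUnion_null_iff, measure_iUnion_null_iff]
    refine ⟨fun i => ?_, fun i => measure_iUnion_null fun j => hausdorffMeasure_two_segment _ _⟩
    exact measure_mono_null (singleton_subset_iff.2 (left_mem_segment ℝ _ _))
      (hausdorffMeasure_two_segment (T.node i).loc (T.node i).loc)

/-- Near a preimage of a leaf, only points of the segment at this leaf are in the tree. -/
theorem exists_forall_mem_segmentOn (T : Q.GeometricTree) {P : Set E2} {f : E2 → SurfacePoint}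
    (S : Q.IsometricCover P f) {i j : Fin T.size} (hij : T.graph.Adj i j)
    (hleaf : ∀ k, T.graph.Adj i k → k = j) {p : E2} (hp : f p = T.node i) :
    ∃ ε > 0, ∀ q ∈ P, dist q p < ε → f q ∈ T.support →
      f q ∈ Q.segmentOn (T.sheet i j) (T.node i) (T.node j) := by
  -- Such a set has at most one point, because `f` preserves distances on a piece.
  have hc1 : ∀ a : Fin S.size × Fin T.size, IsClosed {q | q ∈ S.piece a.1 ∧ f q = T.node a.2} := by
    intro a
    refine Subsingleton.isClosed fun q hq q' hq' => ?_
    rw [← dist_eq_zero, ← S.dist_loc a.1 q hq.1 q' hq'.1, hq.2, hq'.2, dist_self]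
  have hseg : ∀ a b : E3, IsClosed (segment ℝ a b) := fun a b => by
    rw [← convexHull_pair]
    exact ((toFinite {a, b}).isCompact_convexHull (𝕜 := ℝ)).isClosed
  have hc2 : ∀ a : Fin S.size × Fin T.size × Fin T.size, IsClosed {q | q ∈ S.piece a.1 ∧
      T.graph.Adj a.2.1 a.2.2 ∧
      f q ∈ Q.segmentOn (T.sheet a.2.1 a.2.2) (T.node a.2.1) (T.node a.2.2)} := by
    rintro ⟨k, a, b⟩
    by_cases hab : T.graph.Adj a b
    · convert (S.continuousOn_loc k).preimage_isClosed_of_isClosed (S.isCompact_piece k).isClosed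
        ((isClosed_setOf_point_eq (S.sheet_mem k) (T.sheet_mem a b hab)).inter
          (hseg (T.node a).loc (T.node b).loc)) using 1
      ext q
      constructor
      · rintro ⟨hq, -, z, hz, hzq⟩
        have hz' : z = (f q).loc := congrArg SurfacePoint.loc hzq
        subst hz'
        exact ⟨hq, ⟨S.loc_mem k q hq, T.segment_subset_face hab hz,
          (S.apply_eq k q hq).symm.trans hzq.symm⟩, hz⟩
      · rintro ⟨hq, ⟨-, -, h⟩, hz⟩
        exact ⟨hq, hab, _, hz, h.symm.trans (S.apply_eq k q hq).symm⟩
    · simp [hab]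
  obtain ⟨ε₁, hε₁, H₁⟩ := Metric.exists_pos_forall_mem_of_isClosed hc1 p
  obtain ⟨ε₂, hε₂, H₂⟩ := Metric.exists_pos_forall_mem_of_isClosed hc2 p
  refine ⟨min ε₁ ε₂, lt_min hε₁ hε₂, fun q hq hqp hqT => ?_⟩
  obtain ⟨k, hk⟩ := S.exists_piece hq
  rcases hqT with ⟨a, ha⟩ | ⟨a, b, hab, hqab⟩
  · have := (H₁ (k, a) q ⟨hk, ha.symm⟩ (hqp.trans_le (min_le_left _ _))).2
    rw [hp] at this
    rw [← ha, ← this]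
    exact T.node_mem_segmentOn hij
  · have h1 := (H₂ (k, a, b) q ⟨hk, hab, hqab⟩ (hqp.trans_le (min_le_right _ _))).2.2
    rw [hp] at h1
    by_cases hs : s(i, j) = s(a, b)
    · rcases Sym2.eq_iff.1 hs with ⟨rfl, rfl⟩ | ⟨rfl, rfl⟩
      · exact hqab
      · rw [segmentOn_symm]
        exact hqab
    -- A different segment through the leaf would have the leaf as an end, giving it a second
    -- neighbour.
    · exfalso
      rcases (T.inter_subset i j a b hij hab hs ⟨T.node_mem_segmentOn hij, h1⟩).2 with h | h
      · have h := T.node_injective h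
        subst h
        exact hs (by rw [hleaf b hab])
      · have h := T.node_injective h
        subst h
        exact hs (by rw [hleaf a hab.symm, Sym2.eq_swap])

end GeometricTree

/-! ### ### Preimages of leaves and sharpness -/

namespace IsFolding

variable {T : Q.GeometricTree} {P : Set E2} {f : E2 → SurfacePoint}

theorem mem_frontier (hf : Q.IsFolding T P f) {p : E2} (hp : p ∈ P) (hpT : f p ∈ T.support) :
    p ∈ frontier P :=
  ⟨subset_closure hp, fun h => (hf.bijOn_interior.mapsTo h).2 hpT⟩

/-- A leaf of the cut tree has a unique preimage: otherwise points of the adjacent segment would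
have three preimages, and half a disc near each of them. -/
theorem eq_of_apply_eq_leaf (hf : Q.IsFolding T P f) (hP : IsConvexPolygon P) {i : Fin T.size}
    (hi : T.IsLeaf i) {p p' : E2} (hp : p ∈ P) (hp' : p' ∈ P) (hpi : f p = T.node i)
    (hpi' : f p' = T.node i) : p = p' := by
  classical
  by_contra hne
  obtain ⟨S⟩ := hf.nonempty_isometricCover
  obtain ⟨⟨s, hs⟩, hint⟩ := hP
  obtain ⟨j, hij, hleaf⟩ := hi
  have hconv : Convex ℝ P := hs ▸ convex_convexHull ℝ _
  have hclosed : IsClosed P := hs ▸ (s.finite_toSet.isCompact_convexHull (𝕜 := ℝ)).isClosed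
  have hnode : T.node i ∈ T.support := Or.inl ⟨i, rfl⟩
  set a := (T.node i).loc with ha
  set b := (T.node j).loc with hb
  have hab : a ≠ b := T.loc_node_ne hij
  have hd : 0 < dist a b := dist_pos.2 hab
  obtain ⟨ε₁, hε₁, H₁⟩ := hconv.exists_ne_mem_frontier_sphere hclosed hint
    (hf.mem_frontier hp (hpi ▸ hnode))
  obtain ⟨ε₂, hε₂, H₂⟩ := hconv.exists_ne_mem_frontier_sphere hclosed hint
    (hf.mem_frontier hp' (hpi' ▸ hnode))
  -- near a preimage of the leaf, a boundary point goes to the segment at the leaf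
  have hloc : ∀ p ∈ P, f p = T.node i → ∃ ε > 0, ∀ q ∈ frontier P, dist q p < ε → q ≠ p →
      q ∉ s ∧ f q ∈ Q.segmentOn (T.sheet i j) (T.node i) (T.node j) ∧
        dist (f q).loc a = dist q p := by
    intro p hp hpi
    obtain ⟨ε₁, hε₁, H₁⟩ := T.exists_forall_mem_segmentOn S hij hleaf hpi
    obtain ⟨ε₂, hε₂, H₂⟩ := S.exists_forall_mem_piece p
    obtain ⟨ε₃, hε₃, H₃⟩ := Metric.exists_pos_forall_mem_of_isClosed
      (A := fun v : s => {(v : E2)}) (fun v => isClosed_singleton) p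
    refine ⟨min ε₁ (min ε₂ ε₃), lt_min hε₁ (lt_min hε₂ hε₃), fun q hq hqp hqne => ?_⟩
    rw [lt_min_iff, lt_min_iff] at hqp
    have hqP := hclosed.frontier_subset hq
    obtain ⟨k, hk⟩ := S.exists_piece hqP
    refine ⟨fun hqs => hqne (H₃ ⟨q, hqs⟩ q rfl hqp.2.2).symm, H₁ q hqP hqp.1 ?_, ?_⟩
    · rw [← hf.image_frontier]
      exact mem_image_of_mem f hq
    · rw [← S.dist_loc k q hk p (H₂ k q hk hqp.2.1), hpi]
  obtain ⟨ε₃, hε₃, H₃⟩ := hloc p hp hpi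
  obtain ⟨ε₄, hε₄, H₄⟩ := hloc p' hp' hpi'
  -- `r < dist a b` puts the common image strictly inside the segment; `r < dist p p' / 2` separates
  -- `q₃` from `q₁` and `q₂`.
  obtain ⟨r, hr, hlt⟩ := exists_between (show 0 <
    min ε₁ (min ε₂ (min ε₃ (min ε₄ (min (dist a b) (dist p p' / 2))))) from
      lt_min hε₁ (lt_min hε₂ (lt_min hε₃ (lt_min hε₄ (lt_min hd (half_pos (dist_pos.2 hne)))))))
  simp only [lt_min_iff] at hlt
  obtain ⟨h1, h2, h3, h4, h5, h6⟩ := hlt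
  obtain ⟨q₁, hq₁, q₂, hq₂, hq₁₂, hd₁, hd₂⟩ := H₁ r hr h1
  obtain ⟨q₃, hq₃, -, -, -, hd₃, -⟩ := H₂ r hr h2
  have hne_of : ∀ {q p : E2}, dist q p = r → q ≠ p := fun hd h => by
    rw [h, dist_self] at hd
    exact hr.ne hd
  have hfar : ∀ q, dist q p = r → q ≠ q₃ := fun q hq h => by
    subst h
    have := dist_triangle_left p p' q
    linarith
  set c := AffineMap.lineMap a b (r / dist a b) with hc
  set y := Q.point (T.sheet i j) c with hy
  have hcmem : c ∈ openSegment ℝ a b := by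
    rw [openSegment_eq_image_lineMap]
    exact mem_image_of_mem _ ⟨div_pos hr hd, (div_lt_one hd).2 h5⟩
  have hval : ∀ q, f q ∈ Q.segmentOn (T.sheet i j) (T.node i) (T.node j) → dist (f q).loc a = r →
      f q = y := by
    rintro q ⟨z, hz, hzq⟩ hdq
    have hz' : (f q).loc = z := by rw [← hzq, point_loc]
    rw [hz'] at hdq
    rw [segment_eq_image_lineMap] at hz
    obtain ⟨t, ht, rfl⟩ := hz
    rw [dist_lineMap_left, Real.norm_of_nonneg ht.1] at hdq
    rw [← hzq, hy, hc, ← hdq, mul_div_cancel_right₀ _ hd.ne']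
  set Z : Finset E2 := {q₁, q₂, q₃} with hZ
  have hcard : Z.card = 3 := Finset.card_eq_three.2
    ⟨q₁, q₂, q₃, hq₁₂, hfar q₁ hd₁, hfar q₂ hd₂, rfl⟩
  have hZp : ∀ q ∈ Z, q ∈ frontier P ∧ q ∉ s ∧ f q = y := by
    intro q hq
    simp only [hZ, Finset.mem_insert, Finset.mem_singleton] at hq
    rcases hq with rfl | rfl | rfl
    · obtain ⟨e1, e2, e3⟩ := H₃ q hq₁ (hd₁.trans_lt h3) (hne_of hd₁)
      exact ⟨hq₁, e1, hval q e2 (e3.trans hd₁)⟩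
    · obtain ⟨e1, e2, e3⟩ := H₃ q hq₂ (hd₂.trans_lt h3) (hne_of hd₂)
      exact ⟨hq₂, e1, hval q e2 (e3.trans hd₂)⟩
    · obtain ⟨e1, e2, e3⟩ := H₄ q hq₃ (hd₃.trans_lt h4) (hne_of hd₃)
      exact ⟨hq₃, e1, hval q e2 (e3.trans hd₃)⟩
  -- A point of `P` outside the generating set `s` is not extreme, so it is inside a segment in `P`.
  have hhalf : ∀ q : Z, ∃ ε > 0, ∀ r ≤ ε, discArea r ≤ 2 * μH[2] (P ∩ Metric.ball (q : E2) r) := by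
    rintro ⟨q, hq⟩
    obtain ⟨hqf, hqs, -⟩ := hZp q hq
    have hqP := hclosed.frontier_subset hqf
    have hext : q ∉ P.extremePoints ℝ := fun h =>
      hqs (extremePoints_convexHull_subset (hs ▸ h))
    rw [mem_extremePoints] at hext
    push Not at hext
    obtain ⟨x₁, hx₁, x₂, hx₂, hx, hx'⟩ := hext hqP
    refine hconv.exists_le_two_mul_area_inter_ball hint hx₁ hx₂ ?_ hx
    rintro rfl
    rw [openSegment_same] at hx
    exact hx' hx.symm hx.symm
  choose ε hε hhalf using hhalf
  have hfin : y.incident.Finite := Q.finite_sheets.subset fun v hv => hv.1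
  obtain ⟨δ, hδ, hsum⟩ := S.exists_sum_area_le hconv hf.bijOn_interior.injOn hfin (Z := Z)
    fun q hq => ⟨hclosed.frontier_subset (hZp q hq).1, (hZp q hq).2.2⟩
  obtain ⟨δ', hδ', hle⟩ := exists_pos_forall_le hε
  set ρ := min δ δ'
  have hρ : 0 < ρ := lt_min hδ hδ'
  have hb' := T.segment_subset_face hij (right_mem_segment ℝ _ _)
  have hfinal : 3 * discArea ρ ≤ 2 * discArea ρ := by
    calc 3 * discArea ρ = ∑ q ∈ Z, discArea ρ := by
          rw [Finset.sum_const, hcard, nsmul_eq_mul, Nat.cast_ofNat]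
      _ ≤ ∑ q ∈ Z, 2 * μH[2] (P ∩ Metric.ball q ρ) :=
          Finset.sum_le_sum fun q hq => hhalf ⟨q, hq⟩ ρ ((min_le_right _ _).trans (hle ⟨q, hq⟩))
      _ = 2 * ∑ q ∈ Z, μH[2] (P ∩ Metric.ball q ρ) := (Finset.mul_sum ..).symm
      _ ≤ 2 * ∑ u ∈ hfin.toFinset, μH[2] (Q.face u ∩ Metric.ball c ρ) := by
          gcongr
          exact hsum ρ (min_le_left _ _)
      _ ≤ 2 * discArea ρ := by
          gcongr
          exact sum_area_le_discArea (T.sheet_mem i j hij) (T.node_mem_sheet i j hij).1 hb' hab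
            hcmem hfin ρ
  rw [ENNReal.mul_le_mul_iff_left (discArea_ne_zero hρ) (discArea_ne_top ρ)] at hfinal
  norm_num at hfinal

/-- The unique preimage `p` of the leaf is on the frontier of `P`, so the surface near the leaf has
at most half the area of a disc, which bounds the sum of face angles by `π`. -/
theorem isSharpVertex_of_isLeaf (hf : Q.IsFolding T P f) (hP : IsConvexPolygon P) {i : Fin T.size}
    (hi : T.IsLeaf i) : Q.IsSharpVertex (T.node i) := by
  have hπ := Real.pi_pos
  suffices h : Real.pi ≤ Q.curvature (T.node i) from
    ⟨⟨T.node_mem i, (hπ.trans_le h).ne'⟩, h⟩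
  obtain ⟨S⟩ := hf.nonempty_isometricCover
  obtain ⟨⟨s, hs⟩, -⟩ := id hP
  have hconv : Convex ℝ P := hs ▸ convex_convexHull ℝ _
  have hclosed : IsClosed P := hs ▸ (s.finite_toSet.isCompact_convexHull (𝕜 := ℝ)).isClosed
  have hnode : T.node i ∈ f '' frontier P := hf.image_frontier ▸ Or.inl ⟨i, rfl⟩
  obtain ⟨p, hpf, hpi⟩ := hnode
  have hp := hclosed.frontier_subset hpf
  have hfin : (f p).incident.Finite := finite_incident (S.mem_surface hp)
  obtain ⟨ε, hε, H⟩ := S.exists_sum_area_face_le (N := T.support)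
    (hf.bijOn_interior.image_eq.symm.subset.trans (image_mono interior_subset))
    (fun u _ => T.area_support u) hp
    (fun q hq h => hf.eq_of_apply_eq_leaf hP hi hq hp (h.trans hpi) hpi) hfin
  rw [← hpi, curvature, finsum_mem_eq_finite_toFinset_sum _ hfin]
  set A : E3 → ℝ := fun u => faceAngle (Q.face u) (f p).loc
  set n : ℝ := (hfin.toFinset.card : ℝ)
  have key : ∀ δ > 0, ∑ u ∈ hfin.toFinset, (A u - δ) ≤ Real.pi := by
    intro δ hδ
    have hinc : ∀ u : hfin.toFinset, _ := fun u =>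
      incident_subset (S.mem_surface hp) (hfin.mem_toFinset.1 u.2)
    choose ε' hε' H' using fun u : hfin.toFinset =>
      exists_faceAngle_le_area (hinc u).1 (hinc u).2.1 hδ
    obtain ⟨ε₁, hε₁, hle⟩ := exists_pos_forall_le hε'
    set r := min ε ε₁
    have hr : 0 < r := lt_min hε hε₁
    have h1 : (∑ u ∈ hfin.toFinset, ENNReal.ofReal ((A u - δ) / (2 * Real.pi)) * 2) * discArea r ≤
        1 * discArea r := by
      calc _ = 2 * ∑ u ∈ hfin.toFinset,
            ENNReal.ofReal ((A u - δ) / (2 * Real.pi)) * discArea r := by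
            rw [← Finset.sum_mul, ← Finset.sum_mul]
            ring
        _ ≤ 2 * ∑ u ∈ hfin.toFinset, μH[2] (Q.face u ∩ Metric.ball (f p).loc r) := by
            gcongr with u hu
            exact H' ⟨u, hu⟩ r hr ((min_le_right _ _).trans (hle ⟨u, hu⟩))
        _ ≤ 2 * μH[2] (P ∩ Metric.ball p r) := by
            gcongr
            exact H r (min_le_left _ _)
        _ ≤ 1 * discArea r := by
            rw [one_mul]
            exact hconv.two_mul_area_inter_ball_le hpf.2 r
    rw [ENNReal.mul_le_mul_iff_left (discArea_ne_zero hr) (discArea_ne_top r), ← Finset.sum_mul]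
      at h1
    have h2 : ENNReal.ofReal (∑ u ∈ hfin.toFinset, (A u - δ) / (2 * Real.pi)) ≤
        ∑ u ∈ hfin.toFinset, ENNReal.ofReal ((A u - δ) / (2 * Real.pi)) :=
      Finset.le_sum_of_subadditive _ ENNReal.ofReal_zero.le (fun _ _ => ENNReal.ofReal_add_le) _ _
    have h3 : ENNReal.ofReal ((∑ u ∈ hfin.toFinset, (A u - δ) / (2 * Real.pi)) * 2) ≤ 1 := by
      rw [ENNReal.ofReal_mul' (by norm_num), ENNReal.ofReal_ofNat]
      exact (mul_le_mul_left h2 _).trans h1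
    rw [ENNReal.ofReal_le_one, ← Finset.sum_div] at h3
    rw [div_mul_eq_mul_div, div_le_one (by positivity)] at h3
    linarith
  have hle : ∑ u ∈ hfin.toFinset, A u ≤ Real.pi := by
    refine le_of_forall_pos_le_add fun η hη => ?_
    have hn : 0 ≤ n := Nat.cast_nonneg _
    -- The `n` slacks add up to less than `η`; the `+ 1` avoids dividing by zero.
    have h1 := key (η / (n + 1)) (by positivity)
    rw [Finset.sum_sub_distrib, Finset.sum_const, nsmul_eq_mul] at h1
    have h2 : n * (η / (n + 1)) ≤ η := by
      rw [mul_div_assoc', div_le_iff₀ (by positivity)]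
      nlinarith
    linarith
  linarith

/-- With at most one node there are no segments, so all of the frontier of `P` would go to one
point. But two close frontier points lie in a common piece, where distances are preserved. -/
theorem nontrivial_nodes (hf : Q.IsFolding T P f) (hP : IsConvexPolygon P) :
    Nontrivial (Fin T.size) := by
  by_contra hsub
  rw [not_nontrivial_iff_subsingleton] at hsub
  obtain ⟨S⟩ := hf.nonempty_isometricCover
  obtain ⟨⟨s, hs⟩, hint⟩ := hP
  have hconv : Convex ℝ P := hs ▸ convex_convexHull ℝ _
  have hcomp : IsCompact P := hs ▸ s.finite_toSet.isCompact_convexHull (𝕜 := ℝ)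
  obtain ⟨p, hp⟩ := nonempty_frontier_iff.2 ⟨hint.mono interior_subset, hcomp.ne_univ⟩
  obtain ⟨ε₁, hε₁, H₁⟩ := hconv.exists_ne_mem_frontier_sphere hcomp.isClosed hint hp
  obtain ⟨ε₂, hε₂, H₂⟩ := S.exists_forall_mem_piece p
  have hr : 0 < min ε₁ ε₂ / 2 := half_pos (lt_min hε₁ hε₂)
  have hr' : min ε₁ ε₂ / 2 < min ε₁ ε₂ := half_lt_self (lt_min hε₁ hε₂)
  obtain ⟨q, hq, -, -, -, hd, -⟩ := H₁ _ hr (hr'.trans_le (min_le_left _ _))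
  have hT : ∀ q ∈ frontier P, ∃ a, T.node a = f q := fun q hq => by
    have : f q ∈ T.support := hf.image_frontier ▸ mem_image_of_mem f hq
    rcases this with h | ⟨a, b, hab, -⟩
    · exact h
    · exact absurd (Subsingleton.elim a b) hab.ne
  obtain ⟨a, ha⟩ := hT p hp
  obtain ⟨b, hb⟩ := hT q hq
  obtain ⟨k, hk⟩ := S.exists_piece (hcomp.isClosed.frontier_subset hq)
  have h1 := S.dist_loc k q hk p (H₂ k q hk (hd.trans_lt (hr'.trans_le (min_le_right _ _))))
  rw [← ha, ← hb, Subsingleton.elim a b, dist_self, hd] at h1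
  exact hr.ne h1

end IsFolding

end Polytope

theorem mainTheorem1 (Q : Polytope) (T : Q.GeometricTree) (h : Q.HasConvexUnfoldingVia T) :
    (∀ i, T.IsLeaf i → Q.IsSharpVertex (T.node i)) ∧
      ∃ p q, p ≠ q ∧ Q.IsSharpVertex p ∧ Q.IsSharpVertex q := by
  classical
  obtain ⟨P, hP, f, hf⟩ := h
  have hsharp : ∀ i, T.IsLeaf i → Q.IsSharpVertex (T.node i) := fun i hi =>
    hf.isSharpVertex_of_isLeaf hP hi
  have := hf.nontrivial_nodes hP
  obtain ⟨i, j, hij, hi, hj⟩ := T.isTree.exists_ne_and_degree_eq_one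
  rw [SimpleGraph.degree_eq_one_iff_existsUnique_adj] at hi hj
  exact ⟨hsharp, T.node i, T.node j, T.node_injective.ne hij, hsharp i hi, hsharp j hj⟩
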